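/- For $k\in\mathbb N$ and $h\in\mathbb R$ let $S^{(k)}(h)=(\cos 2\pi kh,\sin 2\pi kh)\in\mathbb R^2$. For $\sigma>0$ and a family $p=(p(\cdot\,|\,h))_{h\in[0,1]}$ of probability measures on $\mathbb R^2$, define for $D:\mathbb R^2\times[0,1]\to\mathbb R^2$ the denoising loss $$\mathcal J_{\sigma,p}(D)=\mathbb E_{h\sim\mathcal U([0,1])}\,\mathbb E_{u\sim p(\cdot|h)}\,\mathbb E_{\eta\sim\mathcal N(0,\sigma^2 I)}\,\|D(u+\eta;h)-u\|^2 .$$ Given $L^\ast>0$, $\tilde\epsilon>0$ and $\sigma>0$, let - $D^{(k)}$ be a minimizer of $\mathcal J_{\sigma,p}$ for $p(\cdot\,|\,h)=\delta_{S^{(k)}(h)}$ among all $D$ that are $L^\ast$-Lipschitz jointly in $(u,h)\in\mathbb R^2\times[0,1]$ (Euclidean distances); - $\tilde D^{(k)}$ be a minimizer of $\mathcal J_{\sigma,p}$ for $p(\cdot\,|\,h)=\nu^{(k)}(\cdot\,|\,h):=\mathrm{Law}\big[S^{(k)}(h+\delta h)\big]$, $\delta h\sim\mathcal U([-\tilde\epsilon,\tilde\epsilon])$,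 among all measurable $D$. Let $\mu=\mathcal U(\mathbb S^1)\otimes\mathcal U([0,1])$. There exist constants $C>0$ and $L_0>0$ such that for every $L^\ast\ge L_0$, every $\tilde\epsilon>0$ and every $\sigma>0$ these minimizers exist for all $k$, and, for any choice of them, $$\limsup_{k\to\infty}\ \mathbb E_{(u,h)\sim\mu}\,\mathbb E_{\eta\sim\mathcal N(0,\sigma^2 I)}\left\|D^{(k)}(u+\eta;h)-\tilde D^{(k)}(u+\eta;h)\right\|^2\ \le\ C\,e^{-L^\ast/(8C)} .$$ In particular $C$ and $L_0$ do not depend on $\sigma$ (nor on $\tilde\epsilon$). -/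

import Mathlib

open MeasureTheory ProbabilityTheory Filter
open scoped ENNReal

noncomputable section

/-- The Euclidean plane `ℝ²`. -/
abbrev Plane : Type := EuclideanSpace ℝ (Fin 2)

/-- The oscillatory map `S⁽ᵏ⁾(h) = (cos 2πkh, sin 2πkh)`, for every real `h`. -/
def oscMap (k : ℕ) (h : ℝ) : Plane :=
  !₂[Real.cos (2 * Real.pi * k * h), Real.sin (2 * Real.pi * k * h)]

/-- The isotropic Gaussian `N(0, σ² I)` on the plane. -/
def gaussianNoise (σ : ℝ) : Measure Plane :=
  (stdGaussian Plane).map (fun x => σ • x)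

/-- The uniform probability measure on the unit circle (normalized arc length), as the law of
`(cos 2πt, sin 2πt)` for `t` uniform on `[0,1]`. -/
def uniformCircle : Measure Plane :=
  (volume : Measure unitInterval).map
    (fun t : unitInterval => !₂[Real.cos (2 * Real.pi * (t : ℝ)), Real.sin (2 * Real.pi * (t : ℝ))])

/-- The uniform probability measure on the interval `[-ε, ε]`. -/
def uniformSym (ε : ℝ) : Measure ℝ :=
  ProbabilityTheory.cond volume (Set.Icc (-ε) ε)

/-- The conditional law `δ(u - S⁽ᵏ⁾(h))` of the toy model, given `h ∈ [0,1]`. -/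
def modelLaw (k : ℕ) (h : unitInterval) : Measure Plane :=
  Measure.dirac (oscMap k h)

/-- The smoothed conditional law given `h ∈ [0,1]`: the law of `S⁽ᵏ⁾(h + δh)` with `δh` uniform on
`[-ε, ε]`. -/
def smoothedLaw (k : ℕ) (ε : ℝ) (h : unitInterval) : Measure Plane :=
  (uniformSym ε).map (fun δ => oscMap k (h + δ))

/-- The denoising objective at noise level `σ`,
`E_{h ∼ U[0,1]} E_{u ∼ p(·|h)} E_{η ∼ N(0,σ²I)} ‖D(u + η; h) - u‖²`,
for a family `p` of conditional laws. It takes values in `[0, ∞]`. -/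
def denoisingLoss (σ : ℝ) (p : unitInterval → Measure Plane) (D : Plane → unitInterval → Plane) : ℝ≥0∞ :=
  ∫⁻ h : unitInterval, ∫⁻ u, ∫⁻ η, ‖D (u + η) h - u‖ₑ ^ 2 ∂(gaussianNoise σ) ∂(p h)

/-- Denoisers `D : ℝ² × [0,1] → ℝ²` that are `L`-Lipschitz jointly in `(u, h)`, for the Euclidean
distance. -/
def lipschitzDenoisers (L : ℝ) : Set (Plane → unitInterval → Plane) :=
  {D | ∀ u u' : Plane, ∀ h h' : unitInterval,
    dist (D u h) (D u' h') ≤ L * Real.sqrt (dist u u' ^ 2 + dist h h' ^ 2)}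

/-- All (jointly Borel measurable) denoisers `D : ℝ² × [0,1] → ℝ²`. -/
def measurableDenoisers : Set (Plane → unitInterval → Plane) :=
  {D | Measurable (Function.uncurry D)}

/-- `D` is an optimal `L`-Lipschitz constrained denoiser at noise level `σ` for the family `p`. -/
def IsConstrainedOptimalDenoiser (L σ : ℝ) (p : unitInterval → Measure Plane) (D : Plane → unitInterval → Plane) :
    Prop :=
  D ∈ lipschitzDenoisers L ∧ IsMinOn (denoisingLoss σ p) (lipschitzDenoisers L) D

/-- `D` is an optimal unconstrained denoiser at noise level `σ` for the family `p`. -/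
def IsOptimalDenoiser (σ : ℝ) (p : unitInterval → Measure Plane) (D : Plane → unitInterval → Plane) : Prop :=
  D ∈ measurableDenoisers ∧ IsMinOn (denoisingLoss σ p) measurableDenoisers D

/-- The mean square distance
`E_{(u,h) ∼ U(S¹) ⊗ U[0,1]} E_{η ∼ N(0,σ²I)} ‖D(u + η; h) - D'(u + η; h)‖²`. -/
def denoiserSqDist (σ : ℝ) (D D' : Plane → unitInterval → Plane) : ℝ≥0∞ :=
  ∫⁻ z : Plane × unitInterval, ∫⁻ η, ‖D (z.1 + η) z.2 - D' (z.1 + η) z.2‖ₑ ^ 2 ∂(gaussianNoise σ)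
    ∂(uniformCircle.prod (volume : Measure unitInterval))

end

/-! ### The Gaussian noise on the plane -/

/-! Write `M` for `circlePosteriorMean σ`, the best denoiser when `u` is uniform on the circle
independently of `h`. Both minimizers are compared with `M`.

Smoothed side. The unconstrained minimizer is, almost everywhere, the posterior mean for the
smoothed law. The window of width `2ε` covers `2εk` periods of `oscMap k`, so this law is nearly
uniform on the circle. The numerator and denominator of the posterior mean each carry a relative
error of at most `1/(εk)`, which gives a distance to `M` of at most `2/(εk)`, uniformly in `y`, `h`,
`σ` (`norm_posteriorMean_uniformSym_sub_le`).

Constrained side. A Lipschitz denoiser cannot follow fast oscillations: for denoisers bounded by 1,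
the losses for the Dirac family and for the uniform circle differ by at most `(4L + 8)/k`
(`abs_integral_phaseLoss_sub_le`). The minimizer is bounded by 1, since projecting onto the unit
ball can only help. By the bias-variance identity, the excess circle loss of `D` over `M` is exactly
`denoiserSqDist σ D M` (`denoisingLoss_uniformCircle`). So, up to `O(L/k)`, the minimizer is at
least as close to `M` as any `L`-Lipschitz competitor bounded by 1.

The competitor (`exists_lipschitz_near_circlePosteriorMean`). The derivative of `M` is a posterior
covariance divided by `σ²`, so `M` is `1/σ²`-Lipschitz and serves itself when `1/σ² ≤ L`. For
smaller `σ`, the posterior spread at `y` is at most `4σ²/‖y‖`; this cancels `1/σ²` away from the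
origin, and damping `M` inside radius `1/4` yields the Lipschitz constant 36 for every `σ`. Damping
matters only where the likelihood ratio is at most `exp(-1/(4σ²)) ≤ exp(-L/4)`, which is the
exponential error. -/

instance isProbabilityMeasure_gaussianNoise (σ : ℝ) : IsProbabilityMeasure (gaussianNoise σ) :=
  Measure.isProbabilityMeasure_map (by fun_prop)

/-- The density of the isotropic Gaussian `N(0, σ² I)` on the plane. -/
noncomputable def planeGaussianPDF (σ : ℝ) (x : Plane) : ℝ :=
  (2 * Real.pi * σ ^ 2)⁻¹ * Real.exp (-(‖x‖ ^ 2 / (2 * σ ^ 2)))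

lemma measurable_planeGaussianPDF (σ : ℝ) : Measurable (planeGaussianPDF σ) := by
  unfold planeGaussianPDF; fun_prop

lemma planeGaussianPDF_pos {σ : ℝ} (hσ : 0 < σ) (x : Plane) : 0 < planeGaussianPDF σ x := by
  unfold planeGaussianPDF; positivity

lemma integral_planeGaussianPDF_mul_cexp {σ : ℝ} (hσ : 0 < σ) (t : Plane) :
    ∫ x : Plane, (planeGaussianPDF σ x : ℂ) * Complex.exp (inner ℝ x t * Complex.I)
      = Complex.exp (-(σ ^ 2 * ‖t‖ ^ 2 / 2 : ℝ)) := by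
  have hb : 0 < ((1 / (2 * σ ^ 2) : ℝ) : ℂ).re := by
    rw [Complex.ofReal_re]; positivity
  have h := GaussianFourier.integral_cexp_neg_mul_sq_norm_add hb Complex.I t
  have hσ' : (σ : ℂ) ≠ 0 := by exact_mod_cast hσ.ne'
  have hπ : (Real.pi : ℂ) ≠ 0 := by exact_mod_cast Real.pi_ne_zero
  have e : ∀ x : Plane, (planeGaussianPDF σ x : ℂ) * Complex.exp (inner ℝ x t * Complex.I)
      = (2 * Real.pi * σ ^ 2 : ℂ)⁻¹ * Complex.exp (-((1 / (2 * σ ^ 2) : ℝ) : ℂ) * ‖x‖ ^ 2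
          + Complex.I * inner ℝ t x) := by
    intro x
    rw [Complex.exp_add, planeGaussianPDF, real_inner_comm]
    push_cast
    rw [mul_assoc]
    congr 2
    · congr 1; ring
    · congr 1; ring
  simp_rw [e]
  rw [integral_const_mul, h, finrank_euclideanSpace_fin]
  rw [Nat.cast_ofNat, div_self (by norm_num : (2 : ℂ) ≠ 0), Complex.cpow_one, ← mul_assoc]
  have : (2 * Real.pi * σ ^ 2 : ℂ)⁻¹ * (Real.pi / ((1 / (2 * σ ^ 2) : ℝ) : ℂ)) = 1 := by
    push_cast; field_simp
  rw [this, one_mul]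
  congr 1
  rw [Complex.I_sq]
  push_cast; field_simp; norm_num

lemma gaussianNoise_eq_withDensity {σ : ℝ} (hσ : 0 < σ) :
    gaussianNoise σ = volume.withDensity (fun x => ENNReal.ofReal (planeGaussianPDF σ x)) := by
  have hint : Integrable (planeGaussianPDF σ) := by
    -- Were the density not integrable, its Bochner integral would be 0, whereas the Fourier
    -- identity at `t = 0` gives 1.
    by_contra hni
    have h := integral_planeGaussianPDF_mul_cexp hσ 0
    have h2 : ∫ x : Plane, (planeGaussianPDF σ x : ℂ) = 0 := by
      rw [integral_complex_ofReal, integral_undef hni]; rfl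
    simp [h2] at h
  have : IsFiniteMeasure (volume.withDensity (fun x => ENNReal.ofReal (planeGaussianPDF σ x))) :=
    isFiniteMeasure_withDensity_ofReal hint.2
  apply Measure.ext_of_charFun
  ext t
  rw [gaussianNoise, charFun_map_smul, charFun_stdGaussian, charFun_apply,
    integral_withDensity_eq_integral_toReal_smul
      (measurable_planeGaussianPDF σ).ennreal_ofReal (by simp)]
  have h := integral_planeGaussianPDF_mul_cexp hσ t
  simp_rw [ENNReal.toReal_ofReal (planeGaussianPDF_pos hσ _).le, Complex.real_smul]
  rw [h, norm_smul]
  congr 1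
  push_cast
  rw [mul_pow, Real.norm_eq_abs, ← Complex.ofReal_pow |σ|, sq_abs]
  push_cast; ring

/-- Full support upgrades almost everywhere identities between continuous denoisers to identities
everywhere. -/
lemma isOpenPosMeasure_gaussianNoise {σ : ℝ} (hσ : 0 < σ) :
    (gaussianNoise σ).IsOpenPosMeasure := by
  rw [gaussianNoise_eq_withDensity hσ]
  refine (withDensity_absolutelyContinuous' (measurable_planeGaussianPDF σ).ennreal_ofReal.aemeasurable
    (Eventually.of_forall fun x => ?_)).isOpenPosMeasure
  simpa using planeGaussianPDF_pos hσ x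

/-- The likelihood ratio of `u + η` against `η`, for `η ∼ N(0, σ² I)` and a unit vector `u`. -/
noncomputable def tiltWeight (σ : ℝ) (u y : Plane) : ℝ :=
  Real.exp ((inner ℝ u y - 1 / 2) / σ ^ 2)

lemma tiltWeight_pos (σ : ℝ) (u y : Plane) : 0 < tiltWeight σ u y := Real.exp_pos _

lemma continuous_tiltWeight (σ : ℝ) : Continuous (fun z : Plane × Plane => tiltWeight σ z.1 z.2) := by
  unfold tiltWeight; fun_prop

/-- Shifting a Gaussian by `u` multiplies its density by an explicit exponential. All observations
`u + η` are thereby compared with one reference measure, so that `u` can be integrated out at fixed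
`y`. -/
lemma lintegral_gaussianNoise_add {σ : ℝ} (hσ : 0 < σ) {u : Plane} (hu : ‖u‖ = 1)
    {f : Plane → ℝ≥0∞} (hf : Measurable f) :
    ∫⁻ η, f (u + η) ∂gaussianNoise σ
      = ∫⁻ η, ENNReal.ofReal (tiltWeight σ u η) * f η ∂gaussianNoise σ := by
  have hm := (measurable_planeGaussianPDF σ).ennreal_ofReal
  have hw : Measurable (fun η => ENNReal.ofReal (tiltWeight σ u η)) := by
    unfold tiltWeight; fun_prop
  rw [gaussianNoise_eq_withDensity hσ, lintegral_withDensity_eq_lintegral_mul _ hm (by fun_prop),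
    lintegral_withDensity_eq_lintegral_mul _ hm (by fun_prop)]
  rw [← lintegral_add_left_eq_self _ (-u)]
  refine lintegral_congr fun x => ?_
  simp only [Pi.mul_apply]
  rw [← mul_assoc, ← ENNReal.ofReal_mul (planeGaussianPDF_pos hσ _).le, add_neg_cancel_left]
  congr 2
  rw [planeGaussianPDF, planeGaussianPDF, tiltWeight, mul_assoc (_⁻¹), ← Real.exp_add]
  congr 2
  rw [neg_add_eq_sub, norm_sub_sq_real, hu, real_inner_comm]
  field_simp
  ring

/-! ### Posterior means -/

/-- The marginal likelihood ratio `E w(T, y)` of the observation `y = T + η`, for `T` random on the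
unit circle. -/
noncomputable def posteriorMass {S : Type*} [MeasurableSpace S] (σ : ℝ) (m : Measure S)
    (T : S → Plane) (y : Plane) : ℝ :=
  ∫ s, tiltWeight σ (T s) y ∂m

/-- The posterior mean `E[T | T + η = y]`. -/
noncomputable def posteriorMean {S : Type*} [MeasurableSpace S] (σ : ℝ) (m : Measure S)
    (T : S → Plane) (y : Plane) : Plane :=
  (posteriorMass σ m T y)⁻¹ • ∫ s, tiltWeight σ (T s) y • T s ∂m

lemma enorm_sq_eq_ofReal {E : Type*} [SeminormedAddCommGroup E] (x : E) :
    ‖x‖ₑ ^ 2 = ENNReal.ofReal (‖x‖ ^ 2) := by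
  rw [ENNReal.ofReal_pow (norm_nonneg _), ofReal_norm]

/-! ### Posterior means for a single law on the circle -/

section Fixed

variable {S : Type*} [MeasurableSpace S] {m : Measure S} [IsProbabilityMeasure m] {T : S → Plane}

lemma measurable_tiltWeight_comp (hT : Measurable T) (σ : ℝ) (y : Plane) :
    Measurable fun s => tiltWeight σ (T s) y := by
  unfold tiltWeight; fun_prop

lemma tiltWeight_le (σ : ℝ) {u : Plane} (hu : ‖u‖ = 1) (y : Plane) :
    tiltWeight σ u y ≤ Real.exp (‖y‖ / σ ^ 2) := by
  unfold tiltWeight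
  gcongr
  have := real_inner_le_norm u y
  rw [hu, one_mul] at this
  linarith

lemma integrable_tiltWeight (hT : Measurable T) (hT1 : ∀ s, ‖T s‖ = 1) (σ : ℝ) (y : Plane) :
    Integrable (fun s => tiltWeight σ (T s) y) m := by
  refine Integrable.of_bound (measurable_tiltWeight_comp hT σ y).aestronglyMeasurable
    (Real.exp (‖y‖ / σ ^ 2)) (Eventually.of_forall fun s => ?_)
  rw [Real.norm_of_nonneg (tiltWeight_pos _ _ _).le]
  exact tiltWeight_le σ (hT1 s) y

lemma integrable_tiltWeight_smul {E : Type*} [NormedAddCommGroup E] [NormedSpace ℝ E]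
    (hT : Measurable T) (hT1 : ∀ s, ‖T s‖ = 1) (σ : ℝ) (y : Plane) {f : S → E}
    (hf : AEStronglyMeasurable f m) {B : ℝ} (hB : ∀ s, ‖f s‖ ≤ B) :
    Integrable (fun s => tiltWeight σ (T s) y • f s) m :=
  (integrable_tiltWeight hT hT1 σ y).smul_bdd B hf (Eventually.of_forall hB)

lemma posteriorMass_pos (hT : Measurable T) (hT1 : ∀ s, ‖T s‖ = 1) (σ : ℝ) (y : Plane) :
    0 < posteriorMass σ m T y :=
  integral_exp_pos (f := fun s => (inner ℝ (T s) y - 1 / 2) / σ ^ 2)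
    (integrable_tiltWeight hT hT1 σ y)

lemma posteriorMass_smul_posteriorMean (hT : Measurable T) (hT1 : ∀ s, ‖T s‖ = 1) (σ : ℝ)
    (y : Plane) :
    posteriorMass σ m T y • posteriorMean σ m T y = ∫ s, tiltWeight σ (T s) y • T s ∂m := by
  rw [posteriorMean, smul_inv_smul₀ (posteriorMass_pos hT hT1 σ y).ne']

lemma norm_posteriorMean_le_one (hT : Measurable T) (hT1 : ∀ s, ‖T s‖ = 1) (σ : ℝ) (y : Plane) :
    ‖posteriorMean σ m T y‖ ≤ 1 := by
  have hZ := posteriorMass_pos (m := m) hT hT1 σ y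
  rw [posteriorMean, norm_smul, norm_inv, Real.norm_of_nonneg hZ.le, inv_mul_le_iff₀ hZ, mul_one]
  refine (norm_integral_le_integral_norm _).trans_eq ?_
  refine integral_congr_ae (Eventually.of_forall fun s => ?_)
  simp [norm_smul, hT1 s, abs_of_pos (tiltWeight_pos _ _ _)]

/-- Bias-variance decomposition of the weighted square loss. -/
lemma integral_tiltWeight_mul_norm_sub_sq (hT : Measurable T) (hT1 : ∀ s, ‖T s‖ = 1) (σ : ℝ)
    (y a : Plane) :
    ∫ s, tiltWeight σ (T s) y * ‖a - T s‖ ^ 2 ∂m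
      = posteriorMass σ m T y * ‖a - posteriorMean σ m T y‖ ^ 2
        + ∫ s, tiltWeight σ (T s) y * ‖posteriorMean σ m T y - T s‖ ^ 2 ∂m := by
  set M := posteriorMean σ m T y with hM
  have hI : ∀ b : Plane, Integrable (fun s => tiltWeight σ (T s) y * ‖b - T s‖ ^ 2) m := by
    intro b
    refine integrable_tiltWeight_smul hT hT1 σ y (f := fun s => ‖b - T s‖ ^ 2)
      (by fun_prop) (B := (‖b‖ + 1) ^ 2) fun s => ?_
    rw [Real.norm_of_nonneg (by positivity)]
    gcongr
    exact (norm_sub_le _ _).trans_eq (by rw [hT1])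
  have hI2 : Integrable (fun s => tiltWeight σ (T s) y • (M - T s)) m := by
    refine integrable_tiltWeight_smul hT hT1 σ y (by fun_prop) (B := ‖M‖ + 1) fun s => ?_
    exact (norm_sub_le _ _).trans_eq (by rw [hT1])
  -- The cross term vanishes: `T - M` has weighted mean zero.
  have h0 : ∫ s, tiltWeight σ (T s) y • (M - T s) ∂m = 0 := by
    simp_rw [smul_sub]
    rw [integral_sub ((integrable_tiltWeight hT hT1 σ y).smul_const M)
      (integrable_tiltWeight_smul hT hT1 σ y (by fun_prop) (B := 1) fun s => (hT1 s).le),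
      integral_smul_const, ← posteriorMass_smul_posteriorMean hT hT1, ← posteriorMass, hM, sub_self]
  have e : ∀ s, tiltWeight σ (T s) y * ‖a - T s‖ ^ 2
      = tiltWeight σ (T s) y * ‖a - M‖ ^ 2 + 2 * inner ℝ (a - M) (tiltWeight σ (T s) y • (M - T s))
        + tiltWeight σ (T s) y * ‖M - T s‖ ^ 2 := by
    intro s
    rw [← sub_add_sub_cancel a M (T s), norm_add_sq_real, inner_smul_right]
    ring
  simp_rw [e]
  rw [integral_add _ (hI M), integral_add ((integrable_tiltWeight hT hT1 σ y).mul_const _)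
    ((hI2.const_inner (a - M)).const_mul 2), integral_mul_const, integral_const_mul,
    integral_inner hI2, h0, inner_zero_right, mul_zero, add_zero, posteriorMass]
  exact ((integrable_tiltWeight hT hT1 σ y).mul_const _).add ((hI2.const_inner (a - M)).const_mul 2)

lemma lintegral_tiltWeight_mul_enorm_sub_sq (hT : Measurable T) (hT1 : ∀ s, ‖T s‖ = 1) (σ : ℝ)
    (y a : Plane) :
    ∫⁻ s, ENNReal.ofReal (tiltWeight σ (T s) y) * ‖a - T s‖ₑ ^ 2 ∂m
      = ENNReal.ofReal (posteriorMass σ m T y) * ‖a - posteriorMean σ m T y‖ₑ ^ 2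
        + ∫⁻ s, ENNReal.ofReal (tiltWeight σ (T s) y) * ‖posteriorMean σ m T y - T s‖ₑ ^ 2 ∂m := by
  have key : ∀ b : Plane, ∫⁻ s, ENNReal.ofReal (tiltWeight σ (T s) y) * ‖b - T s‖ₑ ^ 2 ∂m
      = ENNReal.ofReal (∫ s, tiltWeight σ (T s) y * ‖b - T s‖ ^ 2 ∂m) := by
    intro b
    rw [ofReal_integral_eq_lintegral_ofReal]
    · refine lintegral_congr fun s => ?_
      rw [ENNReal.ofReal_mul (tiltWeight_pos _ _ _).le, enorm_sq_eq_ofReal]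
    · refine integrable_tiltWeight_smul hT hT1 σ y (f := fun s => ‖b - T s‖ ^ 2)
        (by fun_prop) (B := (‖b‖ + 1) ^ 2) fun s => ?_
      rw [Real.norm_of_nonneg (by positivity)]
      gcongr
      exact (norm_sub_le _ _).trans_eq (by rw [hT1])
    · exact Eventually.of_forall fun s => mul_nonneg (tiltWeight_pos _ _ _).le (by positivity)
  have hZ := posteriorMass_pos (m := m) hT hT1 σ y
  rw [key, key, integral_tiltWeight_mul_norm_sub_sq hT hT1, enorm_sq_eq_ofReal,
    ← ENNReal.ofReal_mul hZ.le, ENNReal.ofReal_add (by positivity)]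
  exact integral_nonneg fun s => mul_nonneg (tiltWeight_pos _ _ _).le (by positivity)

end Fixed

/-! ### Families of laws indexed by `h`: optimality of the posterior mean -/

section Family

variable {S : Type*} [MeasurableSpace S] {m : Measure S} [IsProbabilityMeasure m]
  {T : unitInterval → S → Plane}

lemma denoisingLoss_map {σ : ℝ} (hσ : 0 < σ) (hT : Measurable (Function.uncurry T))
    (hT1 : ∀ h s, ‖T h s‖ = 1) {D : Plane → unitInterval → Plane}
    (hD : Measurable (Function.uncurry D)) :
    denoisingLoss σ (fun h => m.map (T h)) D
      = ∫⁻ h, ∫⁻ y, ∫⁻ s, ENNReal.ofReal (tiltWeight σ (T h s) y) * ‖D y h - T h s‖ₑ ^ 2 ∂m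
          ∂gaussianNoise σ := by
  unfold denoisingLoss
  refine lintegral_congr fun h => ?_
  have hTh : Measurable (T h) := hT.of_uncurry_left
  have hDh : Measurable fun y => D y h := hD.of_uncurry_right
  have hDc : Measurable fun z : Plane × Plane => ‖D (z.1 + z.2) h - z.1‖ₑ ^ 2 :=
    (((hDh.comp (measurable_fst.add measurable_snd)).sub measurable_fst).enorm.pow_const 2)
  rw [lintegral_map (Measurable.lintegral_prod_right' hDc) hTh]
  have hm : Measurable fun z : Plane × S =>
      ENNReal.ofReal (tiltWeight σ (T h z.2) z.1) * ‖D z.1 h - T h z.2‖ₑ ^ 2 :=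
    (((continuous_tiltWeight σ).measurable.comp
        ((hTh.comp measurable_snd).prodMk measurable_fst)).ennreal_ofReal).mul
      (((hDh.comp measurable_fst).sub (hTh.comp measurable_snd)).enorm.pow_const 2)
  refine Eq.trans (lintegral_congr fun s => ?_) (lintegral_lintegral_swap hm.aemeasurable).symm
  exact lintegral_gaussianNoise_add hσ (hT1 h s) (f := fun y => ‖D y h - T h s‖ₑ ^ 2)
    ((hDh.sub_const _).enorm.pow_const 2)

lemma measurable_posteriorMass (hT : Measurable (Function.uncurry T)) (σ : ℝ) :
    Measurable fun z : Plane × unitInterval => posteriorMass σ m (T z.2) z.1 := by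
  have h1 : Measurable fun q : (Plane × unitInterval) × S => T q.1.2 q.2 :=
    hT.comp (g := Function.uncurry T) (f := fun q : (Plane × unitInterval) × S => (q.1.2, q.2))
      (by fun_prop)
  have h2 : Measurable fun q : (Plane × unitInterval) × S => tiltWeight σ (T q.1.2 q.2) q.1.1 := by
    unfold tiltWeight; fun_prop
  exact (h2.stronglyMeasurable.integral_prod_right' (ν := m)).measurable

lemma measurable_posteriorMean (hT : Measurable (Function.uncurry T)) (σ : ℝ) :
    Measurable fun z : Plane × unitInterval => posteriorMean σ m (T z.2) z.1 := by
  refine (measurable_posteriorMass hT σ).inv.smul ?_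
  refine (StronglyMeasurable.integral_prod_right' (f := fun q : (Plane × unitInterval) × S =>
    tiltWeight σ (T q.1.2 q.2) q.1.1 • T q.1.2 q.2) (Measurable.stronglyMeasurable ?_)).measurable
  have h1 : Measurable fun q : (Plane × unitInterval) × S => T q.1.2 q.2 :=
    hT.comp (g := Function.uncurry T) (f := fun q : (Plane × unitInterval) × S => (q.1.2, q.2))
      (by fun_prop)
  exact Measurable.smul ((continuous_tiltWeight σ).measurable.comp
    (g := fun z : Plane × Plane => tiltWeight σ z.1 z.2) (h1.prodMk (by fun_prop))) h1

/-- The excess loss of a denoiser over the posterior mean. -/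
lemma denoisingLoss_eq_add {σ : ℝ} (hσ : 0 < σ) (hT : Measurable (Function.uncurry T))
    (hT1 : ∀ h s, ‖T h s‖ = 1) {D : Plane → unitInterval → Plane}
    (hD : Measurable (Function.uncurry D)) :
    denoisingLoss σ (fun h => m.map (T h)) D
      = (∫⁻ h, ∫⁻ y, ENNReal.ofReal (posteriorMass σ m (T h) y)
          * ‖D y h - posteriorMean σ m (T h) y‖ₑ ^ 2 ∂gaussianNoise σ)
        + denoisingLoss σ (fun h => m.map (T h)) (fun y h => posteriorMean σ m (T h) y) := by
  rw [denoisingLoss_map hσ hT hT1 hD,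
    denoisingLoss_map hσ hT hT1 (D := fun y h => posteriorMean σ m (T h) y)
      (measurable_posteriorMean hT σ)]
  have hmeas : Measurable fun q : unitInterval × Plane => ENNReal.ofReal (posteriorMass σ m (T q.1) q.2)
          * ‖D q.2 q.1 - posteriorMean σ m (T q.1) q.2‖ₑ ^ 2 :=
    ((measurable_posteriorMass hT σ).comp measurable_swap).ennreal_ofReal.mul
      ((((hD.sub (measurable_posteriorMean hT σ)).comp measurable_swap)).enorm.pow_const 2)
  rw [← lintegral_add_left hmeas.lintegral_prod_right']
  refine lintegral_congr fun h => ?_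
  refine Eq.trans ?_ (lintegral_add_left (hmeas.comp measurable_prodMk_left) _)
  refine lintegral_congr fun y => ?_
  exact lintegral_tiltWeight_mul_enorm_sub_sq hT.of_uncurry_left (hT1 h) σ y (D y h)

/-- Serves as a finite upper bound for minimal losses, so that they can be cancelled in `[0, ∞]`. -/
lemma denoisingLoss_zero {σ : ℝ} {p : unitInterval → Measure Plane}
    [∀ h, IsProbabilityMeasure (p h)] (hp : ∀ h, ∀ᵐ u ∂p h, ‖u‖ = 1) :
    denoisingLoss σ p (fun _ _ => 0) = 1 := by
  unfold denoisingLoss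
  have : ∀ h, ∫⁻ u, ∫⁻ η, ‖(0 : Plane) - u‖ₑ ^ 2 ∂(gaussianNoise σ) ∂(p h) = 1 := by
    intro h
    rw [lintegral_congr_ae (g := fun _ => 1), lintegral_const, measure_univ, one_mul]
    filter_upwards [hp h] with u hu
    rw [lintegral_const, measure_univ, mul_one, enorm_sq_eq_ofReal, zero_sub, norm_neg, hu]
    simp
  simp_rw [this]
  simp

lemma denoisingLoss_posteriorMean_ne_top {σ : ℝ} (hσ : 0 < σ) (hT : Measurable (Function.uncurry T))
    (hT1 : ∀ h s, ‖T h s‖ = 1) :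
    denoisingLoss σ (fun h => m.map (T h)) (fun y h => posteriorMean σ m (T h) y) ≠ ∞ := by
  have : ∀ h, IsProbabilityMeasure (m.map (T h)) := fun h =>
    Measure.isProbabilityMeasure_map hT.of_uncurry_left.aemeasurable
  have h0 := denoisingLoss_eq_add (m := m) hσ hT hT1 (D := fun _ _ => 0) measurable_const
  rw [denoisingLoss_zero] at h0
  · intro h
    rw [h] at h0
    simp at h0
  · intro h
    rw [ae_map_iff hT.of_uncurry_left.aemeasurable (measurableSet_eq_fun (by fun_prop) (by fun_prop))]
    exact Eventually.of_forall (hT1 h)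

lemma isOptimalDenoiser_posteriorMean {σ : ℝ} (hσ : 0 < σ) (hT : Measurable (Function.uncurry T))
    (hT1 : ∀ h s, ‖T h s‖ = 1) :
    IsOptimalDenoiser σ (fun h => m.map (T h)) (fun y h => posteriorMean σ m (T h) y) := by
  refine ⟨measurable_posteriorMean hT σ, fun D hD => ?_⟩
  rw [Set.mem_ofPred_eq, denoisingLoss_eq_add hσ hT hT1 hD]
  exact le_add_self

/-- Optimality forces the excess loss to vanish, and its weight `posteriorMass` is strictly
positive. -/
lemma IsOptimalDenoiser.ae_eq_posteriorMean {σ : ℝ} (hσ : 0 < σ)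
    (hT : Measurable (Function.uncurry T)) (hT1 : ∀ h s, ‖T h s‖ = 1)
    {D : Plane → unitInterval → Plane} (hD : IsOptimalDenoiser σ (fun h => m.map (T h)) D) :
    ∀ᵐ h, ∀ᵐ y ∂gaussianNoise σ, D y h = posteriorMean σ m (T h) y := by
  have hle := isMinOn_iff.1 hD.2 (fun y h => posteriorMean σ m (T h) y)
    (measurable_posteriorMean hT σ)
  rw [denoisingLoss_eq_add hσ hT hT1 hD.1] at hle
  have h0 : (∫⁻ h, ∫⁻ y, ENNReal.ofReal (posteriorMass σ m (T h) y)
          * ‖D y h - posteriorMean σ m (T h) y‖ₑ ^ 2 ∂gaussianNoise σ) = 0 := by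
    have hf := denoisingLoss_posteriorMean_ne_top (m := m) hσ hT hT1
    rw [← nonpos_iff_eq_zero]
    refine (ENNReal.add_le_add_iff_right hf).1 ?_
    rwa [zero_add]
  have hmeas : Measurable fun q : unitInterval × Plane => ENNReal.ofReal (posteriorMass σ m (T q.1) q.2)
          * ‖D q.2 q.1 - posteriorMean σ m (T q.1) q.2‖ₑ ^ 2 :=
    ((measurable_posteriorMass hT σ).comp measurable_swap).ennreal_ofReal.mul
      ((((Measurable.sub hD.1 (measurable_posteriorMean hT σ)).comp measurable_swap)).enorm.pow_const 2)
  rw [lintegral_eq_zero_iff hmeas.lintegral_prod_right'] at h0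
  filter_upwards [h0] with h hh
  replace hh := (lintegral_eq_zero_iff (hmeas.comp measurable_prodMk_left)).1 hh
  filter_upwards [hh] with y hy
  have hZ := posteriorMass_pos (m := m) hT.of_uncurry_left (hT1 h) σ y
  simpa [hZ.not_ge, sub_eq_zero] using hy

end Family

/-! ### Lipschitz bounds for posterior means -/

section Fixed

variable {S : Type*} [MeasurableSpace S] {m : Measure S} [IsProbabilityMeasure m] {T : S → Plane}

lemma hasDerivAt_tiltWeight (σ : ℝ) (u x v : Plane) (τ : ℝ) :
    HasDerivAt (fun τ : ℝ => tiltWeight σ u (x + τ • v))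
      (tiltWeight σ u (x + τ • v) * (inner ℝ u v / σ ^ 2)) τ := by
  unfold tiltWeight
  have h : HasDerivAt (fun τ : ℝ => (inner ℝ u (x + τ • v) - 1 / 2) / σ ^ 2)
      (inner ℝ u v / σ ^ 2) τ := by
    have : (fun τ : ℝ => (inner ℝ u (x + τ • v) - 1 / 2) / σ ^ 2)
        = fun τ : ℝ => (τ * inner ℝ u v + (inner ℝ u x - 1 / 2)) / σ ^ 2 := by
      ext τ; rw [inner_add_right, inner_smul_right]; ring
    rw [this]
    simpa using (((hasDerivAt_id τ).mul_const (inner ℝ u v : ℝ)).add_const _).div_const (σ ^ 2)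
  exact h.exp

lemma hasDerivAt_integral_tiltWeight_smul {E : Type*} [NormedAddCommGroup E] [NormedSpace ℝ E]
    (hT : Measurable T) (hT1 : ∀ s, ‖T s‖ = 1) (σ : ℝ)
    {f : S → E} (hf : AEStronglyMeasurable f m) (hf1 : ∀ s, ‖f s‖ ≤ 1) (x v : Plane) (τ : ℝ) :
    HasDerivAt (fun τ : ℝ => ∫ s, tiltWeight σ (T s) (x + τ • v) • f s ∂m)
      (∫ s, (tiltWeight σ (T s) (x + τ • v) * (inner ℝ (T s) v / σ ^ 2)) • f s ∂m) τ := by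
  have hm : ∀ τ : ℝ, AEStronglyMeasurable (fun s => tiltWeight σ (T s) (x + τ • v) • f s) m :=
    fun τ => (measurable_tiltWeight_comp hT σ _).aestronglyMeasurable.smul hf
  refine (hasDerivAt_integral_of_dominated_loc_of_deriv_le (Metric.ball_mem_nhds τ one_pos)
    (F' := fun τ s => (tiltWeight σ (T s) (x + τ • v) * (inner ℝ (T s) v / σ ^ 2)) • f s)
    (bound := fun _ => Real.exp ((‖x‖ + (|τ| + 1) * ‖v‖) / σ ^ 2) * (‖v‖ / σ ^ 2))
    (Eventually.of_forall hm)
    (integrable_tiltWeight_smul hT hT1 σ _ hf hf1) ?_ ?_ (integrable_const _) ?_).2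
  · refine AEStronglyMeasurable.smul (Measurable.aestronglyMeasurable ?_) hf
    exact (measurable_tiltWeight_comp hT σ _).mul (by fun_prop)
  · refine Eventually.of_forall fun s τ' hτ' => ?_
    rw [norm_smul, norm_mul, Real.norm_of_nonneg (tiltWeight_pos _ _ _).le, norm_div,
      Real.norm_of_nonneg (sq_nonneg σ)]
    have h1 : ‖(inner ℝ (T s) v : ℝ)‖ ≤ ‖v‖ := by
      simpa [hT1 s] using norm_inner_le_norm (𝕜 := ℝ) (T s) v
    have hτ : |τ'| ≤ |τ| + 1 := by
      rw [Metric.mem_ball, Real.dist_eq] at hτ'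
      have := abs_sub_abs_le_abs_sub τ' τ
      linarith
    have h2 : ‖x + τ' • v‖ ≤ ‖x‖ + (|τ| + 1) * ‖v‖ := by
      refine (norm_add_le _ _).trans ?_
      rw [norm_smul, Real.norm_eq_abs]
      gcongr
    have h3 := tiltWeight_le σ (hT1 s) (x + τ' • v)
    calc _ ≤ Real.exp (‖x + τ' • v‖ / σ ^ 2) * (‖v‖ / σ ^ 2) * 1 := by
            gcongr
            exact hf1 s
      _ ≤ _ := by
            rw [mul_one]
            gcongr
  · exact Eventually.of_forall fun s τ' _ => (hasDerivAt_tiltWeight σ (T s) x v τ').smul_const (f s)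

/-- The derivative of the posterior mean is a posterior covariance. -/
lemma exists_hasDerivAt_posteriorMean (hT : Measurable T) (hT1 : ∀ s, ‖T s‖ = 1) (σ : ℝ)
    (x v : Plane) (τ : ℝ) (a : Plane) :
    ∃ φ, HasDerivAt (fun τ : ℝ => posteriorMean σ m T (x + τ • v)) φ τ ∧
      ‖φ‖ ≤ ‖v‖ / σ ^ 2 * ((posteriorMass σ m T (x + τ • v))⁻¹ *
        ∫ s, tiltWeight σ (T s) (x + τ • v) * ‖a - T s‖ ^ 2 ∂m) := by
  set y := x + τ • v with hy
  set Z := posteriorMass σ m T y with hZd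
  set M := posteriorMean σ m T y with hM
  have hZ : 0 < Z := posteriorMass_pos hT hT1 σ y
  have hZ' : HasDerivAt (fun τ : ℝ => posteriorMass σ m T (x + τ • v))
      (∫ s, tiltWeight σ (T s) y * (inner ℝ (T s) v / σ ^ 2) ∂m) τ := by
    simpa [posteriorMass] using hasDerivAt_integral_tiltWeight_smul (m := m) hT hT1 σ
      (f := fun _ => (1 : ℝ)) (by fun_prop) (by simp) x v τ
  have hN' := hasDerivAt_integral_tiltWeight_smul (m := m) hT hT1 σ hT.aestronglyMeasurable
    (fun s => (hT1 s).le) x v τ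
  have hd := (hZ'.inv hZ.ne').smul hN'
  refine ⟨_, hd, ?_⟩
  have hiw := integrable_tiltWeight (m := m) hT hT1 σ y
  have hb : ∀ b c : Plane,
      Integrable (fun s => tiltWeight σ (T s) y • (inner ℝ (T s - b) v • (T s - c))) m := by
    intro b c
    refine integrable_tiltWeight_smul hT hT1 σ y (by fun_prop)
      (B := ((1 + ‖b‖) * ‖v‖) * (1 + ‖c‖)) fun s => ?_
    rw [norm_smul]
    gcongr
    · refine (norm_inner_le_norm _ _).trans ?_
      gcongr
      exact (norm_sub_le _ _).trans_eq (by rw [hT1])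
    · exact (norm_sub_le _ _).trans_eq (by rw [hT1])
  have hsq : ∀ b : Plane, Integrable (fun s => tiltWeight σ (T s) y * ‖b - T s‖ ^ 2) m := by
    intro b
    refine integrable_tiltWeight_smul hT hT1 σ y (f := fun s => ‖b - T s‖ ^ 2)
      (by fun_prop) (B := (‖b‖ + 1) ^ 2) fun s => ?_
    rw [Real.norm_of_nonneg (by positivity)]
    gcongr
    exact (norm_sub_le _ _).trans_eq (by rw [hT1])
  have hin : Integrable (fun s => tiltWeight σ (T s) y * inner ℝ (T s) v) m := by
    refine integrable_tiltWeight_smul hT hT1 σ y (f := fun s => (inner ℝ (T s) v : ℝ))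
      (by fun_prop) (B := ‖v‖) fun s => ?_
    simpa [hT1 s] using norm_inner_le_norm (𝕜 := ℝ) (T s) v
  have hTM : Integrable (fun s => tiltWeight σ (T s) y • (T s - M)) m := by
    refine integrable_tiltWeight_smul hT hT1 σ y (by fun_prop) (B := 1 + ‖M‖) fun s => ?_
    exact (norm_sub_le _ _).trans_eq (by rw [hT1])
  have hwM : ∫ s, tiltWeight σ (T s) y • (T s - M) ∂m = 0 := by
    simp_rw [smul_sub]
    rw [integral_sub (integrable_tiltWeight_smul hT hT1 σ y (by fun_prop) (B := 1) fun s => (hT1 s).le)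
      (hiw.smul_const M),
      integral_smul_const, ← posteriorMass_smul_posteriorMean hT hT1, ← posteriorMass, hM, sub_self]
  -- One factor of the covariance may be centred at an arbitrary `a`, because the other, `T - M`,
  -- has weighted mean zero. The choice of `a` is what later exploits concentration.
  have hcov : ∫ s, tiltWeight σ (T s) y • (inner ℝ (T s - a) v • (T s - M)) ∂m
      = ∫ s, tiltWeight σ (T s) y • (inner ℝ (T s - 0) v • (T s - 0)) ∂m
        - (∫ s, tiltWeight σ (T s) y * inner ℝ (T s) v ∂m) • M := by
    have e : ∀ s, tiltWeight σ (T s) y • ((inner ℝ (T s - a) v : ℝ) • (T s - M))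
        = tiltWeight σ (T s) y • ((inner ℝ (T s - 0) v : ℝ) • (T s - 0))
          - (tiltWeight σ (T s) y * inner ℝ (T s) v) • M
          - (inner ℝ a v : ℝ) • (tiltWeight σ (T s) y • (T s - M)) := by
      intro s
      rw [inner_sub_left, sub_zero]
      module
    simp_rw [e]
    have h1 : Integrable (fun s => tiltWeight σ (T s) y • ((inner ℝ (T s - 0) v : ℝ) • (T s - 0))
        - (tiltWeight σ (T s) y * inner ℝ (T s) v) • M) m := (hb 0 0).sub (hin.smul_const M)
    have h2 : Integrable (fun s => (inner ℝ a v : ℝ) • (tiltWeight σ (T s) y • (T s - M))) m :=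
      hTM.smul (inner ℝ a v : ℝ)
    rw [integral_sub h1 h2,
      integral_sub (hb 0 0) (hin.smul_const M), integral_smul, hwM, smul_zero, sub_zero,
      integral_smul_const]
  have hZe : ∫ s, tiltWeight σ (T s) y * (inner ℝ (T s) v / σ ^ 2) ∂m
      = (∫ s, tiltWeight σ (T s) y * inner ℝ (T s) v ∂m) / σ ^ 2 := by
    rw [← integral_div]
    exact integral_congr_ae (Eventually.of_forall fun s => by simp only; ring)
  have hNe : ∫ s, (tiltWeight σ (T s) y * (inner ℝ (T s) v / σ ^ 2)) • T s ∂m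
      = (σ ^ 2)⁻¹ • ∫ s, tiltWeight σ (T s) y • (inner ℝ (T s - 0) v • (T s - 0)) ∂m := by
    rw [← integral_smul]
    exact integral_congr_ae (Eventually.of_forall fun s => by simp only [sub_zero]; module)
  have hφ : Z⁻¹ • (∫ s, (tiltWeight σ (T s) y * (inner ℝ (T s) v / σ ^ 2)) • T s ∂m)
      + (-(∫ s, tiltWeight σ (T s) y * (inner ℝ (T s) v / σ ^ 2) ∂m) / Z ^ 2)
        • ∫ s, tiltWeight σ (T s) y • T s ∂m
      = Z⁻¹ • (σ ^ 2)⁻¹ • ∫ s, tiltWeight σ (T s) y • (inner ℝ (T s - a) v • (T s - M)) ∂m := by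
    rw [hcov, hZe, hNe, ← posteriorMass_smul_posteriorMean hT hT1, ← hZd, ← hM, smul_smul _ Z M]
    have : -((∫ s, tiltWeight σ (T s) y * inner ℝ (T s) v ∂m) / σ ^ 2) / Z ^ 2 * Z
        = - (Z⁻¹ * (σ ^ 2)⁻¹ * (∫ s, tiltWeight σ (T s) y * inner ℝ (T s) v ∂m)) := by
      field_simp
    rw [this]
    module
  refine (congrArg norm hφ).trans_le ?_
  rw [norm_smul, norm_smul, norm_inv, norm_inv, Real.norm_of_nonneg hZ.le,
    Real.norm_of_nonneg (sq_nonneg σ)]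
  have hle : ‖∫ s, tiltWeight σ (T s) y • (inner ℝ (T s - a) v • (T s - M)) ∂m‖
      ≤ ‖v‖ * ∫ s, tiltWeight σ (T s) y * ‖a - T s‖ ^ 2 ∂m := by
    calc _ ≤ ∫ s, ‖tiltWeight σ (T s) y • ((inner ℝ (T s - a) v : ℝ) • (T s - M))‖ ∂m :=
          norm_integral_le_integral_norm _
      _ ≤ ∫ s, ‖v‖ / 2 * (tiltWeight σ (T s) y * ‖a - T s‖ ^ 2
            + tiltWeight σ (T s) y * ‖M - T s‖ ^ 2) ∂m := by
          refine integral_mono (hb a M).norm (((hsq a).add (hsq M)).const_mul _) fun s => ?_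
          simp only
          rw [norm_smul, norm_smul, Real.norm_of_nonneg (tiltWeight_pos _ _ _).le]
          have h1 : ‖(inner ℝ (T s - a) v : ℝ)‖ ≤ ‖a - T s‖ * ‖v‖ := by
            rw [norm_sub_rev a]; exact norm_inner_le_norm _ _
          rw [norm_sub_rev (T s) M]
          have hw := (tiltWeight_pos σ (T s) y).le
          calc _ ≤ tiltWeight σ (T s) y * (‖a - T s‖ * ‖v‖ * ‖M - T s‖) := by gcongr
            _ = tiltWeight σ (T s) y * ‖v‖ * (‖a - T s‖ * ‖M - T s‖) := by ring
            _ ≤ tiltWeight σ (T s) y * ‖v‖ * ((‖a - T s‖ ^ 2 + ‖M - T s‖ ^ 2) / 2) := by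
              gcongr
              linarith [two_mul_le_add_sq ‖a - T s‖ ‖M - T s‖]
            _ = _ := by ring
      _ ≤ _ := by
          rw [integral_const_mul, integral_add (hsq a) (hsq M)]
          -- The posterior mean minimizes the weighted second moment, so both halves of the AM-GM
          -- bound are controlled by the moment about `a`.
          have h1 : ∫ s, tiltWeight σ (T s) y * ‖M - T s‖ ^ 2 ∂m
              ≤ ∫ s, tiltWeight σ (T s) y * ‖a - T s‖ ^ 2 ∂m := by
            rw [integral_tiltWeight_mul_norm_sub_sq hT hT1 σ y a]
            exact le_add_of_nonneg_left (by positivity)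
          calc _ ≤ ‖v‖ / 2 * ((∫ s, tiltWeight σ (T s) y * ‖a - T s‖ ^ 2 ∂m)
                  + ∫ s, tiltWeight σ (T s) y * ‖a - T s‖ ^ 2 ∂m) := by gcongr
            _ = _ := by ring
  calc _ ≤ Z⁻¹ * ((σ ^ 2)⁻¹ * (‖v‖ * ∫ s, tiltWeight σ (T s) y * ‖a - T s‖ ^ 2 ∂m)) := by gcongr
    _ = _ := by ring

/-- Mean value inequality along a segment; the centre `a` may change from point to point. -/
lemma norm_posteriorMean_sub_le_of_segment (hT : Measurable T) (hT1 : ∀ s, ‖T s‖ = 1) (σ : ℝ)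
    (x v : Plane) {K : ℝ}
    (hK : ∀ τ ∈ Set.Icc (0 : ℝ) 1, ∃ a : Plane, (posteriorMass σ m T (x + τ • v))⁻¹ *
        ∫ s, tiltWeight σ (T s) (x + τ • v) * ‖a - T s‖ ^ 2 ∂m ≤ K) :
    ‖posteriorMean σ m T (x + v) - posteriorMean σ m T x‖ ≤ ‖v‖ / σ ^ 2 * K := by
  choose! a ha using hK
  choose φ hφ hφ' using fun τ => exists_hasDerivAt_posteriorMean (m := m) hT hT1 σ x v τ (a τ)
  have := norm_image_sub_le_of_norm_deriv_le_segment_01' (C := ‖v‖ / σ ^ 2 * K)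
    (fun τ _ => (hφ τ).hasDerivWithinAt) (fun τ hτ => (hφ' τ).trans (by
      have := ha τ ⟨hτ.1, hτ.2.le⟩
      gcongr))
  simpa using this

/-- With centre `a = 0` the normalized second moment is exactly 1, since `T` is a unit vector. -/
lemma norm_posteriorMean_sub_le (hT : Measurable T) (hT1 : ∀ s, ‖T s‖ = 1) (σ : ℝ) (x y : Plane) :
    ‖posteriorMean σ m T x - posteriorMean σ m T y‖ ≤ ‖x - y‖ / σ ^ 2 := by
  have h := norm_posteriorMean_sub_le_of_segment (m := m) hT hT1 σ y (x - y) (K := 1)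
    fun τ _ => ⟨0, ?_⟩
  · simpa using h
  · have hZ := posteriorMass_pos (m := m) hT hT1 σ (y + τ • (x - y))
    simp only [zero_sub, norm_neg, hT1, one_pow, mul_one]
    rw [← posteriorMass, inv_mul_cancel₀ hZ.ne']

end Fixed

/-! ### The uniform distribution on the circle -/

lemma continuous_oscMap (k : ℕ) : Continuous (oscMap k) := by
  unfold oscMap
  refine (PiLp.continuous_toLp 2 _).comp (continuous_pi fun i => ?_)
  fin_cases i <;> simp <;> fun_prop

lemma norm_oscMap (k : ℕ) (t : ℝ) : ‖oscMap k t‖ = 1 := by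
  rw [oscMap, EuclideanSpace.norm_eq]
  simp

lemma inner_oscMap (k : ℕ) (t : ℝ) (a : Plane) :
    inner ℝ (oscMap k t) a
      = a 0 * Real.cos (2 * Real.pi * k * t) + a 1 * Real.sin (2 * Real.pi * k * t) := by
  simp [oscMap, PiLp.inner_apply, Fin.sum_univ_two]

lemma oscMap_eq_one (k : ℕ) (t : ℝ) : oscMap k t = oscMap 1 (k * t) := by
  simp [oscMap, mul_assoc]

lemma oscMap_one_periodic : Function.Periodic (oscMap 1) 1 := by
  intro t
  simp [oscMap, mul_add]

lemma uniformCircle_eq_map :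
    uniformCircle = (volume : Measure unitInterval).map (fun t : unitInterval => oscMap 1 t) := by
  simp [uniformCircle, oscMap]

lemma integral_unitInterval {E : Type*} [NormedAddCommGroup E] [NormedSpace ℝ E] (f : ℝ → E) :
    ∫ t : unitInterval, f t = ∫ t in (0 : ℝ)..1, f t := by
  rw [unitInterval.measurePreserving_coe.integral_comp unitInterval.measurableEmbedding_coe,
    integral_Icc_eq_integral_Ioc, intervalIntegral.integral_of_le zero_le_one]

/-- Concentration of the tilted uniform distribution on the circle around the direction of the
tilt. -/
lemma integral_tiltWeight_oscMap_concentration {σ : ℝ} (hσ : 0 < σ) {a : Plane} (ha : ‖a‖ = 1)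
    {r : ℝ} (hr : 0 < r) :
    r / σ ^ 2 * ∫ t in (0 : ℝ)..1, tiltWeight σ (oscMap 1 t) (r • a) * ‖a - oscMap 1 t‖ ^ 2
      ≤ 4 * ∫ t in (0 : ℝ)..1, tiltWeight σ (oscMap 1 t) (r • a) := by
  set c : ℝ → ℝ := fun t => inner ℝ (oscMap 1 t) a with hc
  set b : ℝ → ℝ := fun t => a 1 * Real.cos (2 * Real.pi * t) - a 0 * Real.sin (2 * Real.pi * t) with hb
  set w : ℝ → ℝ := fun t => tiltWeight σ (oscMap 1 t) (r • a) with hw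
  set κ := r / σ ^ 2 with hκ
  have hκ0 : 0 < κ := by positivity
  have hce : ∀ t, c t = a 0 * Real.cos (2 * Real.pi * t) + a 1 * Real.sin (2 * Real.pi * t) := by
    intro t; simp only [hc, inner_oscMap]; simp
  have ha2 : a 0 ^ 2 + a 1 ^ 2 = 1 := by
    have := EuclideanSpace.real_norm_sq_eq a
    rw [ha, Fin.sum_univ_two] at this
    linarith
  have hbc : ∀ t, b t ^ 2 = 1 - c t ^ 2 := by
    intro t
    rw [hce, ← ha2]
    simp only [hb]
    linear_combination (a 0 ^ 2 + a 1 ^ 2) * Real.sin_sq_add_cos_sq (2 * Real.pi * t)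
  have hlin : ∀ t : ℝ, HasDerivAt (fun t : ℝ => 2 * Real.pi * t) (2 * Real.pi) t := fun t => by
    simpa using (hasDerivAt_id t).const_mul (2 * Real.pi)
  have hc' : ∀ t, HasDerivAt c (2 * Real.pi * b t) t := by
    intro t
    have : c = fun t => a 0 * Real.cos (2 * Real.pi * t) + a 1 * Real.sin (2 * Real.pi * t) :=
      funext hce
    rw [this]
    convert! ((hlin t).cos.const_mul (a 0)).add ((hlin t).sin.const_mul (a 1)) using 1
    simp only [hb]; ring
  have hb' : ∀ t, HasDerivAt b (-(2 * Real.pi * c t)) t := by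
    intro t
    convert! ((hlin t).cos.const_mul (a 1)).sub ((hlin t).sin.const_mul (a 0)) using 1
    rw [hce]; ring
  have hwe : ∀ t, w t = Real.exp (κ * c t - 1 / (2 * σ ^ 2)) := by
    intro t
    simp only [hw, tiltWeight, hc, inner_smul_right, hκ]
    congr 1
    field_simp
  have hw' : ∀ t, HasDerivAt w (w t * (κ * (2 * Real.pi * b t))) t := by
    intro t
    have := (((hc' t).const_mul κ).sub_const (1 / (2 * σ ^ 2))).exp
    rw [← hwe] at this
    rwa [show w = fun t => Real.exp (κ * c t - 1 / (2 * σ ^ 2)) from funext hwe] at this ⊢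
  have hcc : Continuous c := continuous_iff_continuousAt.2 fun t => (hc' t).continuousAt
  have hbcont : Continuous b := continuous_iff_continuousAt.2 fun t => (hb' t).continuousAt
  have hwc : Continuous w := continuous_iff_continuousAt.2 fun t => (hw' t).continuousAt
  have hw0 : ∀ t, 0 < w t := fun t => tiltWeight_pos _ _ _
  have hper : b 1 = b 0 ∧ c 1 = c 0 := by
    constructor
    · simp [hb]
    · rw [hce, hce]; simp
  have hw1 : w 1 = w 0 := by rw [hwe, hwe, hper.2]
  have hc1 : ∀ t, |c t| ≤ 1 := by
    intro t
    rw [abs_le_one_iff_mul_self_le_one]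
    nlinarith [hbc t, sq_nonneg (b t)]
  -- integration by parts
  have hparts : ∫ t in (0 : ℝ)..1, (κ * (w t * (1 - c t ^ 2)) - w t * c t) = 0 := by
    have h := intervalIntegral.integral_eq_sub_of_hasDerivAt
      (f := fun t => b t * w t / (2 * Real.pi))
      (f' := fun t => κ * (w t * (1 - c t ^ 2)) - w t * c t) (a := 0) (b := 1) (fun t _ => ?_)
      (Continuous.intervalIntegrable (by fun_prop) _ _)
    · rw [h, hper.1, hw1, sub_self]
    · convert! ((hb' t).mul (hw' t)).div_const (2 * Real.pi) using 1
      rw [← hbc]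
      have := Real.pi_ne_zero
      field_simp
      ring
  -- Under the uniform law `c` has mean 0 and `c ^ 2` has mean `1 / 2`.
  have hzero : ∫ t in (0 : ℝ)..1, (1 - c t) * (c t + 1 / 2) = 0 := by
    have h := intervalIntegral.integral_eq_sub_of_hasDerivAt
      (f := fun t => (b t * c t - b t) / (4 * Real.pi))
      (f' := fun t => (1 - c t) * (c t + 1 / 2)) (a := 0) (b := 1) (fun t _ => ?_)
      (Continuous.intervalIntegrable (by fun_prop) _ _)
    · rw [h, hper.1, hper.2, sub_self]
    · convert! (((hb' t).mul (hc' t)).sub (hb' t)).div_const (4 * Real.pi) using 1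
      have := Real.pi_ne_zero
      field_simp
      linear_combination (-4 : ℝ) * hbc t
  -- Chebyshev-type argument: `w` increases with `c`, and `(1 - c) * (c + 1 / 2)` changes sign at `c
  -- = -1 / 2`. Subtracting the value `w₀` of the weight there costs nothing by `hzero` and makes
  -- the integrand nonnegative.
  have hcorr : 0 ≤ ∫ t in (0 : ℝ)..1, w t * ((1 - c t) * (c t + 1 / 2)) := by
    set w₀ := Real.exp (κ * (-1 / 2) - 1 / (2 * σ ^ 2)) with hw₀
    have h1 : ∫ t in (0 : ℝ)..1, (w t - w₀) * ((1 - c t) * (c t + 1 / 2))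
        = ∫ t in (0 : ℝ)..1, w t * ((1 - c t) * (c t + 1 / 2)) := by
      simp_rw [sub_mul (w _)]
      rw [intervalIntegral.integral_sub (Continuous.intervalIntegrable (by fun_prop) _ _)
        (Continuous.intervalIntegrable (by fun_prop) _ _), intervalIntegral.integral_const_mul,
        hzero, mul_zero, sub_zero]
    rw [← h1]
    refine intervalIntegral.integral_nonneg zero_le_one fun t _ => ?_
    have h2 : 0 ≤ 1 - c t := by linarith [(abs_le.1 (hc1 t)).2]
    rcases le_total (-1 / 2) (c t) with h | h
    · have : w₀ ≤ w t := by rw [hwe, hw₀]; gcongr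
      exact mul_nonneg (by linarith) (mul_nonneg h2 (by linarith))
    · have : w t ≤ w₀ := by rw [hwe, hw₀]; gcongr
      exact mul_nonneg_of_nonpos_of_nonpos (by linarith)
        (mul_nonpos_of_nonneg_of_nonpos h2 (by linarith))
  have ii : ∀ f : ℝ → ℝ, Continuous f → IntervalIntegrable f volume 0 1 :=
    fun f hf => hf.intervalIntegrable _ _
  -- The identity `2 - 2c = 4(1 - c²) - 4(1 - c)(c + 1/2)` splits the spread into the term handled
  -- by parts and the term of known sign.
  have hnorm : ∀ t, w t * ‖a - oscMap 1 t‖ ^ 2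
      = 4 * (w t * (1 - c t ^ 2)) - 4 * (w t * ((1 - c t) * (c t + 1 / 2))) := by
    intro t
    rw [norm_sub_sq_real, ha, norm_oscMap, show inner ℝ a (oscMap 1 t) = c t from real_inner_comm _ _]
    ring
  have hcw : ∫ t in (0 : ℝ)..1, w t * c t ≤ ∫ t in (0 : ℝ)..1, w t := by
    refine intervalIntegral.integral_mono_on zero_le_one (ii _ (by fun_prop)) (ii _ hwc) fun t _ => ?_
    exact mul_le_of_le_one_right (hw0 t).le (abs_le.1 (hc1 t)).2
  rw [intervalIntegral.integral_sub (ii _ (by fun_prop)) (ii _ (by fun_prop)),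
    intervalIntegral.integral_const_mul] at hparts
  have hnorm' : ∫ t in (0 : ℝ)..1, tiltWeight σ (oscMap 1 t) (r • a) * ‖a - oscMap 1 t‖ ^ 2
      = ∫ t in (0 : ℝ)..1, (4 * (w t * (1 - c t ^ 2)) - 4 * (w t * ((1 - c t) * (c t + 1 / 2)))) :=
    intervalIntegral.integral_congr fun t _ => hnorm t
  rw [hnorm']
  rw [intervalIntegral.integral_sub (ii _ (by fun_prop)) (ii _ (by fun_prop)),
    intervalIntegral.integral_const_mul, intervalIntegral.integral_const_mul, mul_sub]
  have := mul_nonneg hκ0.le hcorr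
  linarith

/-- The posterior mean of a uniformly distributed point of the circle. -/
noncomputable def circlePosteriorMean (σ : ℝ) (y : Plane) : Plane :=
  posteriorMean σ (volume : Measure unitInterval) (fun t : unitInterval => oscMap 1 t) y

lemma measurable_oscMap_coe : Measurable (fun t : unitInterval => oscMap 1 t) :=
  (continuous_oscMap 1).measurable.comp measurable_subtype_coe

lemma norm_circlePosteriorMean_le_one (σ : ℝ) (y : Plane) : ‖circlePosteriorMean σ y‖ ≤ 1 :=
  norm_posteriorMean_le_one measurable_oscMap_coe (fun _ => norm_oscMap _ _) σ y

lemma norm_circlePosteriorMean_sub_le (σ : ℝ) (x y : Plane) :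
    ‖circlePosteriorMean σ x - circlePosteriorMean σ y‖ ≤ ‖x - y‖ / σ ^ 2 :=
  norm_posteriorMean_sub_le measurable_oscMap_coe (fun _ => norm_oscMap _ _) σ x y

/-- A Lipschitz bound away from the origin that is uniform in the noise level. -/
lemma norm_mul_norm_circlePosteriorMean_sub_le {σ : ℝ} (hσ : 0 < σ) (x y : Plane) :
    ‖x‖ * ‖circlePosteriorMean σ y - circlePosteriorMean σ x‖ ≤ 8 * ‖y - x‖ := by
  -- For distant points the bound `‖M‖ ≤ 1` suffices. Otherwise the segment stays outside radius
  -- `‖x‖ / 2`, where the spread is at most `4σ² / (‖x‖ / 2)`; hence the value of `K`.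
  rcases le_or_gt (‖x‖ / 2) ‖y - x‖ with h | h
  · have h1 : ‖circlePosteriorMean σ y - circlePosteriorMean σ x‖ ≤ 2 := by
      refine (norm_sub_le _ _).trans ?_
      linarith [norm_circlePosteriorMean_le_one σ x, norm_circlePosteriorMean_le_one σ y]
    nlinarith [norm_nonneg x, norm_nonneg (y - x)]
  have hx : 0 < ‖x‖ := by linarith [norm_nonneg (y - x)]
  have key := norm_posteriorMean_sub_le_of_segment (m := (volume : Measure unitInterval))
    measurable_oscMap_coe (fun _ => norm_oscMap _ _) σ x (y - x) (K := 8 * σ ^ 2 / ‖x‖)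
    fun τ hτ => ?_
  · rw [add_sub_cancel] at key
    calc _ ≤ ‖x‖ * (‖y - x‖ / σ ^ 2 * (8 * σ ^ 2 / ‖x‖)) := by
          gcongr; exact key
      _ = _ := by field_simp
  · set z := x + τ • (y - x) with hz
    have hzx : ‖x‖ / 2 ≤ ‖z‖ := by
      have h1 : ‖x‖ ≤ ‖z‖ + ‖τ • (y - x)‖ := by
        have := norm_sub_le z (τ • (y - x))
        rwa [hz, add_sub_cancel_right] at this
      have h2 : ‖τ • (y - x)‖ ≤ ‖y - x‖ := by
        rw [norm_smul, Real.norm_of_nonneg hτ.1]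
        exact mul_le_of_le_one_left (norm_nonneg _) hτ.2
      linarith
    have hz0 : 0 < ‖z‖ := by linarith
    refine ⟨‖z‖⁻¹ • z, ?_⟩
    have ha : ‖‖z‖⁻¹ • z‖ = 1 := by
      rw [norm_smul, norm_inv, norm_norm, inv_mul_cancel₀ hz0.ne']
    have hc := integral_tiltWeight_oscMap_concentration hσ ha hz0
    rw [smul_inv_smul₀ hz0.ne'] at hc
    have hZ := posteriorMass_pos (m := (volume : Measure unitInterval)) measurable_oscMap_coe
      (fun _ => norm_oscMap _ _) σ z
    rw [inv_mul_le_iff₀ hZ]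
    rw [posteriorMass, integral_unitInterval (fun t => tiltWeight σ (oscMap 1 t) z)] at hZ ⊢
    rw [integral_unitInterval (fun t => tiltWeight σ (oscMap 1 t) z * ‖‖z‖⁻¹ • z - oscMap 1 t‖ ^ 2)]
    set I := ∫ t in (0 : ℝ)..1, tiltWeight σ (oscMap 1 t) z * ‖‖z‖⁻¹ • z - oscMap 1 t‖ ^ 2
    set Z := ∫ t in (0 : ℝ)..1, tiltWeight σ (oscMap 1 t) z
    have h3 : I ≤ 4 * Z * σ ^ 2 / ‖z‖ := by
      rw [le_div_iff₀ hz0]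
      rw [div_mul_eq_mul_div, div_le_iff₀ (by positivity)] at hc
      linarith
    calc I ≤ 4 * Z * σ ^ 2 / ‖z‖ := h3
      _ ≤ 4 * Z * σ ^ 2 / (‖x‖ / 2) := by gcongr
      _ = _ := by field_simp; norm_num

/-- The posterior mean on the circle, damped near the origin. -/
noncomputable def dampedPosteriorMean (σ : ℝ) (y : Plane) : Plane :=
  min 1 (4 * ‖y‖) • circlePosteriorMean σ y

/-- Product rule: the factor `4 * ‖x‖` turns the bound `8 * ‖x - y‖ / ‖x‖` into `32 * ‖x - y‖`, and
the cutoff is itself 4-Lipschitz against a vector of norm at most 1. -/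
lemma norm_dampedPosteriorMean_sub_le {σ : ℝ} (hσ : 0 < σ) (x y : Plane) :
    ‖dampedPosteriorMean σ x - dampedPosteriorMean σ y‖ ≤ 36 * ‖x - y‖ := by
  have e : dampedPosteriorMean σ x - dampedPosteriorMean σ y
      = min 1 (4 * ‖x‖) • (circlePosteriorMean σ x - circlePosteriorMean σ y)
        + (min 1 (4 * ‖x‖) - min 1 (4 * ‖y‖)) • circlePosteriorMean σ y := by
    unfold dampedPosteriorMean; module
  have h1 : ‖min 1 (4 * ‖x‖) • (circlePosteriorMean σ x - circlePosteriorMean σ y)‖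
      ≤ 32 * ‖x - y‖ := by
    rw [norm_smul, Real.norm_of_nonneg (by positivity)]
    have := norm_mul_norm_circlePosteriorMean_sub_le hσ x y
    rw [norm_sub_rev y x, norm_sub_rev (circlePosteriorMean σ y)] at this
    calc _ ≤ 4 * ‖x‖ * ‖circlePosteriorMean σ x - circlePosteriorMean σ y‖ := by
          gcongr; exact min_le_right _ _
      _ ≤ _ := by linarith
  have h2 : ‖(min 1 (4 * ‖x‖) - min 1 (4 * ‖y‖)) • circlePosteriorMean σ y‖ ≤ 4 * ‖x - y‖ := by
    rw [norm_smul]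
    have h3 : |min 1 (4 * ‖x‖) - min 1 (4 * ‖y‖)| ≤ 4 * ‖x - y‖ := by
      refine (abs_min_sub_min_le_max _ _ _ _).trans ?_
      rw [sub_self, abs_zero, ← mul_sub, abs_mul, abs_of_pos (four_pos (α := ℝ))]
      refine max_le (by positivity) ?_
      gcongr
      exact abs_norm_sub_norm_le x y
    calc _ ≤ 4 * ‖x - y‖ * 1 := by
          gcongr
          · exact h3
          · exact norm_circlePosteriorMean_le_one σ y
      _ = _ := mul_one _
  rw [e]
  refine (norm_add_le _ _).trans ?_
  linarith

/-! ### The loss against the uniform distribution on the circle -/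

instance isProbabilityMeasure_uniformCircle : IsProbabilityMeasure uniformCircle := by
  rw [uniformCircle_eq_map]
  exact Measure.isProbabilityMeasure_map measurable_oscMap_coe.aemeasurable

lemma continuous_circlePosteriorMean (σ : ℝ) : Continuous (circlePosteriorMean σ) := by
  refine (LipschitzWith.of_dist_le' (K := (σ ^ 2)⁻¹) fun x y => ?_).continuous
  rw [dist_eq_norm, dist_eq_norm, inv_mul_eq_div]
  exact norm_circlePosteriorMean_sub_le σ x y

/-- The marginal likelihood ratio of a noisy uniformly distributed point of the circle. -/
noncomputable def circlePosteriorMass (σ : ℝ) (y : Plane) : ℝ :=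
  posteriorMass σ (volume : Measure unitInterval) (fun t : unitInterval => oscMap 1 t) y

lemma circlePosteriorMass_pos (σ : ℝ) (y : Plane) : 0 < circlePosteriorMass σ y :=
  posteriorMass_pos measurable_oscMap_coe (fun _ => norm_oscMap _ _) σ y

lemma circlePosteriorMass_eq (σ : ℝ) (y : Plane) :
    circlePosteriorMass σ y = ∫ t in (0 : ℝ)..1, tiltWeight σ (oscMap 1 t) y :=
  integral_unitInterval (fun t => tiltWeight σ (oscMap 1 t) y)

lemma circlePosteriorMass_le (σ : ℝ) (y : Plane) :
    circlePosteriorMass σ y ≤ Real.exp ((‖y‖ - 1 / 2) / σ ^ 2) := by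
  have h1 := integrable_tiltWeight (m := (volume : Measure unitInterval)) measurable_oscMap_coe
    (fun _ => norm_oscMap _ _) σ y
  refine (integral_mono h1 (integrable_const (Real.exp ((‖y‖ - 1 / 2) / σ ^ 2))) fun t => ?_).trans
    (by simp)
  unfold tiltWeight
  have := real_inner_le_norm (oscMap 1 t) y
  rw [norm_oscMap, one_mul] at this
  simp only
  gcongr

/-- For `u` uniform on the circle, `u + η` has density `circlePosteriorMass` with respect to the
noise. This is the weight of the excess loss, so the distance to be bounded is an excess loss. -/
lemma denoiserSqDist_eq {σ : ℝ} (hσ : 0 < σ) {D D' : Plane → unitInterval → Plane}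
    (hD : Measurable (Function.uncurry D)) (hD' : Measurable (Function.uncurry D')) :
    denoiserSqDist σ D D' = ∫⁻ h, ∫⁻ y, ENNReal.ofReal (circlePosteriorMass σ y)
      * ‖D y h - D' y h‖ₑ ^ 2 ∂gaussianNoise σ := by
  have hG : Measurable fun q : Plane × unitInterval => ‖D q.1 q.2 - D' q.1 q.2‖ₑ ^ 2 :=
    (hD.sub hD').enorm.pow_const 2
  have hF : Measurable fun z : Plane × unitInterval =>
      ∫⁻ η, ‖D (z.1 + η) z.2 - D' (z.1 + η) z.2‖ₑ ^ 2 ∂(gaussianNoise σ) := by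
    have : Measurable fun q : (Plane × unitInterval) × Plane =>
        ‖D (q.1.1 + q.2) q.1.2 - D' (q.1.1 + q.2) q.1.2‖ₑ ^ 2 :=
      hG.comp (f := fun q : (Plane × unitInterval) × Plane => (q.1.1 + q.2, q.1.2)) (by fun_prop)
    exact this.lintegral_prod_right'
  unfold denoiserSqDist
  rw [lintegral_prod_symm _ hF.aemeasurable]
  refine lintegral_congr fun h => ?_
  have hGh : Measurable fun y => ‖D y h - D' y h‖ₑ ^ 2 :=
    ((hD.of_uncurry_right (y := h)).sub (hD'.of_uncurry_right (y := h))).enorm.pow_const 2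
  have hFh : Measurable fun u => ∫⁻ η, ‖D (u + η) h - D' (u + η) h‖ₑ ^ 2 ∂(gaussianNoise σ) :=
    (hGh.comp measurable_add).lintegral_prod_right' (f := fun q : Plane × Plane => _)
  rw [uniformCircle_eq_map, lintegral_map hFh measurable_oscMap_coe]
  have hc : Measurable fun z : Plane × unitInterval => oscMap 1 z.2 :=
    measurable_oscMap_coe.comp measurable_snd
  have hw : Measurable fun z : Plane × unitInterval => tiltWeight σ (oscMap 1 z.2) z.1 := by
    unfold tiltWeight; fun_prop
  have hm : Measurable fun z : Plane × unitInterval =>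
      ENNReal.ofReal (tiltWeight σ (oscMap 1 z.2) z.1) * ‖D z.1 h - D' z.1 h‖ₑ ^ 2 :=
    hw.ennreal_ofReal.mul (hGh.comp measurable_fst)
  refine Eq.trans (lintegral_congr fun t => lintegral_gaussianNoise_add hσ (norm_oscMap 1 t) hGh)
    ((lintegral_lintegral_swap hm.aemeasurable).symm.trans (lintegral_congr fun y => ?_))
  rw [lintegral_mul_const _ (measurable_tiltWeight_comp measurable_oscMap_coe σ y).ennreal_ofReal]
  congr 1
  exact (ofReal_integral_eq_lintegral_ofReal
    (integrable_tiltWeight measurable_oscMap_coe (fun _ => norm_oscMap _ _) σ y)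
    (Eventually.of_forall fun t => (tiltWeight_pos _ _ _).le)).symm

lemma measurable_uncurry_circlePosteriorMean (σ : ℝ) :
    Measurable (Function.uncurry fun y (_ : unitInterval) => circlePosteriorMean σ y) :=
  (continuous_circlePosteriorMean σ).measurable.comp measurable_fst

/-- The excess loss over the posterior mean, for the uniform distribution on the circle. -/
lemma denoisingLoss_uniformCircle {σ : ℝ} (hσ : 0 < σ) {D : Plane → unitInterval → Plane}
    (hD : Measurable (Function.uncurry D)) :
    denoisingLoss σ (fun _ => uniformCircle) D
      = denoiserSqDist σ D (fun y _ => circlePosteriorMean σ y)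
        + denoisingLoss σ (fun _ => uniformCircle) (fun y _ => circlePosteriorMean σ y) := by
  rw [denoiserSqDist_eq hσ hD (measurable_uncurry_circlePosteriorMean σ), uniformCircle_eq_map]
  exact denoisingLoss_eq_add (T := fun (_ : unitInterval) (t : unitInterval) => oscMap 1 t) hσ
    (measurable_oscMap_coe.comp measurable_snd) (fun _ _ => norm_oscMap _ _) hD

lemma denoisingLoss_uniformCircle_ne_top {σ : ℝ} (hσ : 0 < σ) :
    denoisingLoss σ (fun _ => uniformCircle) (fun y _ => circlePosteriorMean σ y) ≠ ∞ := by
  rw [uniformCircle_eq_map]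
  exact denoisingLoss_posteriorMean_ne_top
    (T := fun (_ : unitInterval) (t : unitInterval) => oscMap 1 t) hσ
    (measurable_oscMap_coe.comp measurable_snd) (fun _ _ => norm_oscMap _ _)

/-- Obtained from two constant denoisers at distance 1. -/
lemma lintegral_circlePosteriorMass {σ : ℝ} (hσ : 0 < σ) :
    ∫⁻ y, ENNReal.ofReal (circlePosteriorMass σ y) ∂gaussianNoise σ = 1 := by
  have h := denoiserSqDist_eq hσ (D := fun _ _ => EuclideanSpace.single 0 1) (D' := fun _ _ => 0)
    measurable_const measurable_const
  have e : ‖(EuclideanSpace.single 0 1 : Plane) - 0‖ₑ ^ 2 = 1 := by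
    rw [enorm_sq_eq_ofReal]; simp
  unfold denoiserSqDist at h
  simp only [e, mul_one, lintegral_const, measure_univ] at h
  exact h.symm

/-- Exponentially accurate approximation of the posterior mean on the circle by Lipschitz
denoisers. -/
lemma exists_lipschitz_near_circlePosteriorMean {L σ : ℝ} (hL : 36 ≤ L) (hσ : 0 < σ) :
    ∃ G : Plane → Plane, (∀ x y, ‖G x - G y‖ ≤ L * ‖x - y‖) ∧ (∀ x, ‖G x‖ ≤ 1) ∧
      denoiserSqDist σ (fun y _ => G y) (fun y _ => circlePosteriorMean σ y)
        ≤ ENNReal.ofReal (Real.exp (-(L / 4))) := by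
  -- At high noise the posterior mean is itself admissible; at low noise it is damped, and `1 / σ ^
  -- 2 > L` makes the price exponentially small in `L`.
  rcases le_or_gt (1 / σ ^ 2) L with h | h
  · refine ⟨circlePosteriorMean σ, fun x y => ?_, norm_circlePosteriorMean_le_one σ, ?_⟩
    · refine (norm_circlePosteriorMean_sub_le σ x y).trans ?_
      rw [div_eq_mul_one_div, mul_comm]
      gcongr
    · simp [denoiserSqDist]
  · have hlip := norm_dampedPosteriorMean_sub_le hσ
    have hcont : Continuous (dampedPosteriorMean σ) :=
      (LipschitzWith.of_dist_le' (K := 36) fun x y => by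
        simpa [dist_eq_norm] using hlip x y).continuous
    refine ⟨dampedPosteriorMean σ, fun x y => (hlip x y).trans (by gcongr), fun x => ?_, ?_⟩
    · rw [dampedPosteriorMean, norm_smul, Real.norm_of_nonneg (by positivity)]
      exact mul_le_one₀ (min_le_left _ _) (norm_nonneg _) (norm_circlePosteriorMean_le_one σ x)
    · rw [denoiserSqDist_eq (D := fun y _ => dampedPosteriorMean σ y) hσ (hcont.measurable.comp measurable_fst)
        (measurable_uncurry_circlePosteriorMean σ)]
      have hle : ∀ y, ENNReal.ofReal (circlePosteriorMass σ y)
          * ‖dampedPosteriorMean σ y - circlePosteriorMean σ y‖ₑ ^ 2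
          ≤ ENNReal.ofReal (Real.exp (-(L / 4))) := by
        intro y
        rw [enorm_sq_eq_ofReal, ← ENNReal.ofReal_mul (circlePosteriorMass_pos σ y).le]
        refine ENNReal.ofReal_le_ofReal ?_
        rcases le_or_gt (1 / 4) ‖y‖ with hy | hy
        · have : dampedPosteriorMean σ y = circlePosteriorMean σ y := by
            rw [dampedPosteriorMean, min_eq_left (by linarith), one_smul]
          rw [this]; simp; positivity
        · have h1 : ‖dampedPosteriorMean σ y - circlePosteriorMean σ y‖ ≤ 1 := by
            have e : dampedPosteriorMean σ y - circlePosteriorMean σ y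
                = (min 1 (4 * ‖y‖) - 1) • circlePosteriorMean σ y := by
              rw [dampedPosteriorMean]; module
            rw [e, norm_smul]
            refine mul_le_one₀ ?_ (norm_nonneg _) (norm_circlePosteriorMean_le_one σ y)
            rw [Real.norm_eq_abs, abs_le]
            have : 0 ≤ min 1 (4 * ‖y‖) := by positivity
            constructor <;> linarith [min_le_left 1 (4 * ‖y‖)]
          have h2 : circlePosteriorMass σ y ≤ Real.exp (-(L / 4)) := by
            refine (circlePosteriorMass_le σ y).trans (Real.exp_le_exp.2 ?_)
            have h3 : 0 < 1 / σ ^ 2 := by positivity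
            rw [div_eq_mul_one_div]
            nlinarith
          calc _ ≤ Real.exp (-(L / 4)) * 1 ^ 2 := by gcongr
            _ = _ := by ring
      calc _ ≤ ∫⁻ _ : unitInterval, ∫⁻ _, ENNReal.ofReal (Real.exp (-(L / 4))) ∂gaussianNoise σ :=
            lintegral_mono fun h => lintegral_mono fun y => hle y
        _ = _ := by simp

/-! ### Smoothed conditional laws -/

/-- Whole periods contribute exactly their mean; the leftover piece, shorter than one period, and
the matching fraction of the mean each cost at most one period of `‖g‖`. -/
lemma norm_integral_sub_le_of_periodic {E : Type*} [NormedAddCommGroup E] [NormedSpace ℝ E]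
    {g : ℝ → E} (hg : Continuous g) (hp : Function.Periodic g 1) (a b : ℝ) :
    ‖(∫ t in a..b, g t) - (b - a) • ∫ t in (0 : ℝ)..1, g t‖ ≤ 2 * ∫ t in (0 : ℝ)..1, ‖g t‖ := by
  set n := ⌊b - a⌋ with hn
  have hi : ∀ x y : ℝ, IntervalIntegrable g volume x y := fun x y => hg.intervalIntegrable _ _
  have hr0 : 0 ≤ b - a - n := sub_nonneg.2 (Int.floor_le _)
  have hr1 : b - a - n ≤ 1 := by linarith [Int.lt_floor_add_one (b - a)]
  have h1 : ∫ t in a..(a + n), g t = (n : ℝ) • ∫ t in (0 : ℝ)..1, g t := by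
    have := hp.intervalIntegral_add_zsmul_eq n a hi
    simpa [hp.intervalIntegral_add_eq a 0, ← Int.cast_smul_eq_zsmul ℝ] using this
  have h2 : ‖∫ t in (a + n)..b, g t‖ ≤ ∫ t in (0 : ℝ)..1, ‖g t‖ := by
    refine (intervalIntegral.norm_integral_le_integral_norm (by linarith)).trans ?_
    have hpn : Function.Periodic (fun t => ‖g t‖) 1 := fun t => by simp only [hp t]
    have e := hpn.intervalIntegral_add_eq (a + n) 0
    rw [zero_add] at e
    rw [← e]
    exact intervalIntegral.integral_mono_interval le_rfl (by linarith) (by linarith)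
      (Eventually.of_forall fun t => norm_nonneg _) (hg.norm.intervalIntegrable _ _)
  have h3 : ‖(b - a - n) • ∫ t in (0 : ℝ)..1, g t‖ ≤ ∫ t in (0 : ℝ)..1, ‖g t‖ := by
    rw [norm_smul, Real.norm_of_nonneg hr0]
    exact (mul_le_of_le_one_left (norm_nonneg _) hr1).trans
      (intervalIntegral.norm_integral_le_integral_norm zero_le_one)
  rw [← intervalIntegral.integral_add_adjacent_intervals (hi a (a + n)) (hi (a + n) b), h1]
  have e : (n : ℝ) • (∫ t in (0 : ℝ)..1, g t) + (∫ t in (a + n)..b, g t)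
      - (b - a) • ∫ t in (0 : ℝ)..1, g t
      = (∫ t in (a + n)..b, g t) - (b - a - n) • ∫ t in (0 : ℝ)..1, g t := by module
  rw [e]
  refine (norm_sub_le _ _).trans ?_
  linarith

lemma isProbabilityMeasure_uniformSym {ε : ℝ} (hε : 0 < ε) : IsProbabilityMeasure (uniformSym ε) := by
  refine cond_isProbabilityMeasure_of_finite ?_ ?_ <;> simp [Real.volume_Icc, hε]

lemma integral_uniformSym {E : Type*} [NormedAddCommGroup E] [NormedSpace ℝ E] {ε : ℝ} (hε : 0 < ε)
    (g : ℝ → E) : ∫ δ, g δ ∂uniformSym ε = (2 * ε)⁻¹ • ∫ δ in (-ε)..ε, g δ := by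
  rw [uniformSym, ProbabilityTheory.cond, integral_smul_measure, Real.volume_Icc,
    integral_Icc_eq_integral_Ioc, intervalIntegral.integral_of_le (by linarith),
    ENNReal.toReal_inv, ENNReal.toReal_ofReal (by linarith)]
  congr 2
  ring

lemma norm_integral_uniformSym_sub_le {E : Type*} [NormedAddCommGroup E] [NormedSpace ℝ E]
    {g : ℝ → E} (hg : Continuous g) (hp : Function.Periodic g 1) {ε : ℝ}
    (hε : 0 < ε) {k : ℕ} (hk : 0 < k) (h : ℝ) :
    ‖(∫ δ, g (k * (h + δ)) ∂uniformSym ε) - ∫ t in (0 : ℝ)..1, g t‖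
      ≤ (ε * k)⁻¹ * ∫ t in (0 : ℝ)..1, ‖g t‖ := by
  have hk' : (0 : ℝ) < k := by exact_mod_cast hk
  have key := norm_integral_sub_le_of_periodic hg hp (k * h + k * (-ε)) (k * h + k * ε)
  have hs : ∫ δ in (-ε)..ε, g (k * (h + δ))
      = (k : ℝ)⁻¹ • ∫ t in (k * h + k * (-ε))..(k * h + k * ε), g t := by
    simp_rw [mul_add]
    exact intervalIntegral.integral_comp_add_mul g hk'.ne' (k * h)
  have e : (∫ δ, g (k * (h + δ)) ∂uniformSym ε) - ∫ t in (0 : ℝ)..1, g t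
      = (2 * ε * k)⁻¹ • ((∫ t in (k * h + k * (-ε))..(k * h + k * ε), g t)
        - (k * h + k * ε - (k * h + k * (-ε))) • ∫ t in (0 : ℝ)..1, g t) := by
    rw [integral_uniformSym hε, hs, smul_sub, smul_smul, smul_smul]
    congr 2
    · field_simp
    · have : (2 * ε * k)⁻¹ * (k * h + k * ε - (k * h + k * (-ε))) = 1 := by field_simp; ring
      rw [this, one_smul]
  rw [e, norm_smul, norm_inv, Real.norm_of_nonneg (by positivity)]
  calc _ ≤ (2 * ε * k)⁻¹ * (2 * ∫ t in (0 : ℝ)..1, ‖g t‖) := by gcongr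
    _ = _ := by field_simp

lemma norm_posteriorMean_uniformSym_sub_le {σ ε : ℝ} (hε : 0 < ε) {k : ℕ} (hk : 0 < k) (h : ℝ)
    (y : Plane) :
    ‖posteriorMean σ (uniformSym ε) (fun δ => oscMap k (h + δ)) y - circlePosteriorMean σ y‖
      ≤ 2 * (ε * k)⁻¹ := by
  have := isProbabilityMeasure_uniformSym hε
  have hT : Measurable fun δ : ℝ => oscMap k (h + δ) :=
    (continuous_oscMap k).measurable.comp (by fun_prop)
  have hT1 : ∀ δ : ℝ, ‖oscMap k (h + δ)‖ = 1 := fun δ => norm_oscMap _ _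
  set Z := circlePosteriorMass σ y with hZ
  have hZ0 : 0 < Z := circlePosteriorMass_pos σ y
  set Zk := posteriorMass σ (uniformSym ε) (fun δ => oscMap k (h + δ)) y with hZk
  set Mk := posteriorMean σ (uniformSym ε) (fun δ => oscMap k (h + δ)) y with hMk
  have hZk0 : 0 < Zk := posteriorMass_pos hT hT1 σ y
  have hwc : Continuous fun t => tiltWeight σ (oscMap 1 t) y :=
    (continuous_tiltWeight σ).comp ((continuous_oscMap 1).prodMk continuous_const)
  have hwp : Function.Periodic (fun t => tiltWeight σ (oscMap 1 t) y) 1 := fun t => by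
    simp only [oscMap_one_periodic t]
  have hnw : ∫ t in (0 : ℝ)..1, ‖tiltWeight σ (oscMap 1 t) y‖ = Z := by
    rw [hZ, circlePosteriorMass_eq]
    exact intervalIntegral.integral_congr fun t _ => Real.norm_of_nonneg (tiltWeight_pos _ _ _).le
  have h1 : ‖Zk - Z‖ ≤ (ε * k)⁻¹ * Z := by
    have := norm_integral_uniformSym_sub_le hwc hwp hε hk h
    rw [hnw, ← circlePosteriorMass_eq] at this
    simp_rw [← oscMap_eq_one] at this
    exact this
  have h2 : ‖Zk • Mk - Z • circlePosteriorMean σ y‖ ≤ (ε * k)⁻¹ * Z := by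
    have := norm_integral_uniformSym_sub_le (g := fun t => tiltWeight σ (oscMap 1 t) y • oscMap 1 t)
      (hwc.smul (continuous_oscMap 1)) (fun t => by simp only [oscMap_one_periodic t]) hε hk h
    simp_rw [norm_smul, norm_oscMap, mul_one, ← oscMap_eq_one] at this
    rw [hnw, ← integral_unitInterval] at this
    rw [hZk, hMk, posteriorMass_smul_posteriorMean hT hT1, hZ, circlePosteriorMass,
      circlePosteriorMean,
      posteriorMass_smul_posteriorMean measurable_oscMap_coe (fun _ => norm_oscMap _ _)]
    exact this
  -- Dividing by the limiting mass `Z` and using `‖Mk‖ ≤ 1` needs only errors relative to `Z`. Both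
  -- are, since `oscMap` has norm 1 and the weight is positive, so the bound is uniform in `y`.
  have e : Mk - circlePosteriorMean σ y
      = Z⁻¹ • ((Zk • Mk - Z • circlePosteriorMean σ y) - (Zk - Z) • Mk) := by
    rw [show (Zk • Mk - Z • circlePosteriorMean σ y) - (Zk - Z) • Mk
      = Z • (Mk - circlePosteriorMean σ y) by module, inv_smul_smul₀ hZ0.ne']
  have hM1 : ‖Mk‖ ≤ 1 := norm_posteriorMean_le_one hT hT1 σ y
  rw [e, norm_smul, norm_inv, Real.norm_of_nonneg hZ0.le, inv_mul_le_iff₀ hZ0]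
  refine (norm_sub_le _ _).trans ?_
  rw [norm_smul]
  calc _ ≤ (ε * k)⁻¹ * Z + (ε * k)⁻¹ * Z * 1 := by gcongr
    _ = _ := by ring

lemma measurable_oscMap_add (k : ℕ) :
    Measurable (Function.uncurry fun (h : unitInterval) (δ : ℝ) => oscMap k (h + δ)) :=
  (continuous_oscMap k).measurable.comp
    (f := fun q : unitInterval × ℝ => (q.1 : ℝ) + q.2) (by fun_prop)

lemma exists_isOptimalDenoiser_smoothedLaw {σ ε : ℝ} (hσ : 0 < σ) (hε : 0 < ε) (k : ℕ) :
    ∃ D, IsOptimalDenoiser σ (smoothedLaw k ε) D := by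
  have := isProbabilityMeasure_uniformSym hε
  exact ⟨_, isOptimalDenoiser_posteriorMean (m := uniformSym ε) hσ (measurable_oscMap_add k)
    (fun _ _ => norm_oscMap _ _)⟩

lemma IsOptimalDenoiser.denoiserSqDist_circlePosteriorMean_le {σ ε : ℝ} (hσ : 0 < σ) (hε : 0 < ε)
    {k : ℕ} (hk : 0 < k) {D : Plane → unitInterval → Plane}
    (hD : IsOptimalDenoiser σ (smoothedLaw k ε) D) :
    denoiserSqDist σ (fun y _ => circlePosteriorMean σ y) D
      ≤ ENNReal.ofReal ((2 * (ε * k)⁻¹) ^ 2) := by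
  have := isProbabilityMeasure_uniformSym hε
  have hae := hD.ae_eq_posteriorMean (m := uniformSym ε) hσ (measurable_oscMap_add k)
    (fun _ _ => norm_oscMap _ _)
  rw [denoiserSqDist_eq hσ (measurable_uncurry_circlePosteriorMean σ) hD.1]
  calc _ ≤ ∫⁻ _ : unitInterval, ∫⁻ y, ENNReal.ofReal (circlePosteriorMass σ y)
        * ENNReal.ofReal ((2 * (ε * k)⁻¹) ^ 2) ∂gaussianNoise σ := by
        refine lintegral_mono_ae ?_
        filter_upwards [hae] with h hh
        refine lintegral_mono_ae ?_
        filter_upwards [hh] with y hy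
        rw [hy, enorm_sq_eq_ofReal]
        gcongr
        rw [norm_sub_rev]
        exact norm_posteriorMean_uniformSym_sub_le hε hk h y
    _ = _ := by
        rw [lintegral_const, measure_univ, mul_one, lintegral_mul_const' _ _ ENNReal.ofReal_ne_top,
          lintegral_circlePosteriorMass hσ, one_mul]

/-! ### Lipschitz denoisers -/

/-- The product carries the sup distance; the Euclidean one is at most `√2 ≤ 2` times larger. -/
lemma lipschitzWith_of_mem_lipschitzDenoisers {L : ℝ} (hL : 0 ≤ L)
    {D : Plane → unitInterval → Plane} (hD : D ∈ lipschitzDenoisers L) :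
    LipschitzWith (Real.toNNReal (L * 2)) (Function.uncurry D) := by
  refine LipschitzWith.of_dist_le' fun x y => (hD x.1 y.1 x.2 y.2).trans ?_
  rw [mul_assoc]
  gcongr
  rw [Prod.dist_eq]
  set m := max (dist x.1 y.1) (dist x.2 y.2)
  have h1 : dist x.1 y.1 ≤ m := le_max_left _ _
  have h2 : dist x.2 y.2 ≤ m := le_max_right _ _
  have hm : 0 ≤ m := dist_nonneg.trans h1
  refine Real.sqrt_le_iff.2 ⟨by positivity, ?_⟩
  have h3 : dist x.1 y.1 ^ 2 ≤ m ^ 2 := by gcongr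
  have h4 : dist x.2 y.2 ^ 2 ≤ m ^ 2 := by gcongr
  nlinarith [sq_nonneg m]

lemma continuous_of_mem_lipschitzDenoisers {L : ℝ} (hL : 0 ≤ L)
    {D : Plane → unitInterval → Plane} (hD : D ∈ lipschitzDenoisers L) :
    Continuous (Function.uncurry D) :=
  (lipschitzWith_of_mem_lipschitzDenoisers hL hD).continuous

/-- The metric projection onto the closed unit ball of the plane. -/
lemma exists_unitBall_projection :
    ∃ π : Plane → Plane, (∀ x, ‖π x‖ ≤ 1) ∧ (∀ x y, ‖π x - π y‖ ≤ ‖x - y‖) ∧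
      ∀ x u : Plane, ‖u‖ ≤ 1 → ‖π x - u‖ ^ 2 + ‖x - π x‖ ^ 2 ≤ ‖x - u‖ ^ 2 := by
  have hne : (Metric.closedBall (0 : Plane) 1).Nonempty := ⟨0, by simp⟩
  have hcv : Convex ℝ (Metric.closedBall (0 : Plane) 1) := convex_closedBall _ _
  have hex : ∀ x : Plane, ∃ v ∈ Metric.closedBall (0 : Plane) 1,
      ∀ w ∈ Metric.closedBall (0 : Plane) 1, inner ℝ (x - v) (w - v) ≤ 0 := by
    intro x
    obtain ⟨v, hv, hvi⟩ := exists_norm_eq_iInf_of_complete_convex hne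
      Metric.isClosed_closedBall.isComplete hcv x
    exact ⟨v, hv, (norm_eq_iInf_iff_real_inner_le_zero hcv hv).1 hvi⟩
  choose π hπ hπi using hex
  refine ⟨π, fun x => by simpa using hπ x, fun x y => ?_, fun x u hu => ?_⟩
  · have h1 := hπi x (π y) (hπ y)
    have h2 := hπi y (π x) (hπ x)
    -- Firm nonexpansiveness: the sum of the two variational inequalities characterizing the
    -- projections.
    have h3 : ‖π x - π y‖ ^ 2 ≤ inner ℝ (x - y) (π x - π y) := by
      have e : inner ℝ (x - y) (π x - π y) = ‖π x - π y‖ ^ 2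
          - inner ℝ (x - π x) (π y - π x) - inner ℝ (y - π y) (π x - π y) := by
        rw [← real_inner_self_eq_norm_sq, ← neg_sub (π x) (π y), inner_neg_right, sub_neg_eq_add,
          ← inner_add_left, ← inner_sub_left]
        congr 1; abel
      linarith
    have h4 := h3.trans (real_inner_le_norm _ _)
    rcases (norm_nonneg (π x - π y)).eq_or_lt with h | h
    · rw [← h]; positivity
    · nlinarith
  · have h1 := hπi x u (by simpa using hu)
    rw [← sub_add_sub_cancel x (π x) u, norm_add_sq_real]
    rw [← neg_sub (π x) u, inner_neg_right] at h1
    linarith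

lemma denoisingLoss_modelLaw (σ : ℝ) (k : ℕ) (D : Plane → unitInterval → Plane) :
    denoisingLoss σ (modelLaw k) D
      = ∫⁻ h : unitInterval, ∫⁻ η, ‖D (oscMap k h + η) h - oscMap k h‖ₑ ^ 2 ∂gaussianNoise σ := by
  simp [denoisingLoss, modelLaw]

lemma measurable_modelLoss_integrand {k : ℕ} {D : Plane → unitInterval → Plane}
    (hD : Measurable (Function.uncurry D)) :
    Measurable fun q : unitInterval × Plane => ‖D (oscMap k q.1 + q.2) q.1 - oscMap k q.1‖ₑ ^ 2 := by
  have h1 : Measurable fun q : unitInterval × Plane => oscMap k q.1 :=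
    (continuous_oscMap k).measurable.comp (f := fun q : unitInterval × Plane => (q.1 : ℝ))
      (by fun_prop)
  have h2 : Measurable fun q : unitInterval × Plane => D (oscMap k q.1 + q.2) q.1 :=
    hD.comp (f := fun q : unitInterval × Plane => (oscMap k q.1 + q.2, q.1)) (by fun_prop)
  exact (h2.sub h1).enorm.pow_const 2

lemma measurable_enorm_sub_sq_left {D : Plane → unitInterval → Plane}
    (hD : Measurable (Function.uncurry D)) (h : unitInterval) (u : Plane) :
    Measurable fun η => ‖D (u + η) h - u‖ₑ ^ 2 :=
  (((hD.of_uncurry_right (y := h)).comp (measurable_const_add u)).sub_const u).enorm.pow_const 2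

lemma comp_mem_lipschitzDenoisers {L : ℝ} {D : Plane → unitInterval → Plane}
    (hD : D ∈ lipschitzDenoisers L) {π : Plane → Plane} (hπ : ∀ x y, ‖π x - π y‖ ≤ ‖x - y‖) :
    (fun u h => π (D u h)) ∈ lipschitzDenoisers L := by
  intro u u' h h'
  refine le_trans ?_ (hD u u' h h')
  rw [dist_eq_norm, dist_eq_norm]
  exact hπ _ _

/-- Projecting a denoiser onto the unit ball improves its loss by the mean square displacement. -/
lemma denoisingLoss_modelLaw_comp_projection {L σ : ℝ} (hL : 0 ≤ L) {k : ℕ}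
    {D : Plane → unitInterval → Plane} (hD : D ∈ lipschitzDenoisers L) {π : Plane → Plane}
    (hπ : ∀ x y, ‖π x - π y‖ ≤ ‖x - y‖)
    (hπ2 : ∀ x u : Plane, ‖u‖ ≤ 1 → ‖π x - u‖ ^ 2 + ‖x - π x‖ ^ 2 ≤ ‖x - u‖ ^ 2) :
    denoisingLoss σ (modelLaw k) (fun u h => π (D u h))
      + (∫⁻ h : unitInterval, ∫⁻ η, ‖D (oscMap k h + η) h - π (D (oscMap k h + η) h)‖ₑ ^ 2
          ∂gaussianNoise σ)
      ≤ denoisingLoss σ (modelLaw k) D := by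
  have hπD : Measurable (Function.uncurry fun u h => π (D u h)) :=
    (continuous_of_mem_lipschitzDenoisers hL (comp_mem_lipschitzDenoisers hD hπ)).measurable
  have hm := measurable_modelLoss_integrand (k := k) hπD
  rw [denoisingLoss_modelLaw, denoisingLoss_modelLaw, ← lintegral_add_left hm.lintegral_prod_right']
  refine lintegral_mono fun h => ?_
  simp only
  rw [← lintegral_add_left (measurable_enorm_sub_sq_left hπD h (oscMap k h))]
  refine lintegral_mono fun η => ?_
  simp only [enorm_sq_eq_ofReal]
  rw [← ENNReal.ofReal_add (by positivity) (by positivity)]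
  exact ENNReal.ofReal_le_ofReal (hπ2 _ _ (norm_oscMap k h).le)

/-- A relatively open set may touch an endpoint, but by density it meets the open interval. -/
lemma isOpenPosMeasure_unitInterval : (volume : Measure unitInterval).IsOpenPosMeasure := by
  refine ⟨fun U hU hne => ?_⟩
  obtain ⟨V, hV, rfl⟩ := isOpen_induced_iff.1 hU
  obtain ⟨x, hx⟩ := hne
  have hx' : (x : ℝ) ∈ closure (Set.Ioo (0 : ℝ) 1) := by
    rw [closure_Ioo zero_ne_one]; exact x.2
  have hne' : (V ∩ Set.Ioo (0 : ℝ) 1).Nonempty := mem_closure_iff.1 hx' V hV hx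
  rw [unitInterval.volume_apply]
  refine ((hV.inter isOpen_Ioo).measure_pos volume hne').ne' ∘ fun h0 => ?_
  refine measure_mono_null (fun y hy => ?_) h0
  exact ⟨⟨y, Set.Ioo_subset_Icc_self hy.2⟩, hy.1, rfl⟩

/-- A constrained optimal denoiser takes values in the unit ball. -/
lemma IsConstrainedOptimalDenoiser.norm_le_one {L σ : ℝ} (hL : 0 ≤ L) (hσ : 0 < σ) {k : ℕ}
    {D : Plane → unitInterval → Plane} (hD : IsConstrainedOptimalDenoiser L σ (modelLaw k) D)
    (u : Plane) (h : unitInterval) : ‖D u h‖ ≤ 1 := by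
  obtain ⟨π, hπ1, hπ, hπ2⟩ := exists_unitBall_projection
  have hle := denoisingLoss_modelLaw_comp_projection (σ := σ) (k := k) hL hD.1 hπ hπ2
  have hπm := comp_mem_lipschitzDenoisers hD.1 hπ
  have hmin := isMinOn_iff.1 hD.2 _ hπm
  have h0mem : (fun _ _ => 0 : Plane → unitInterval → Plane) ∈ lipschitzDenoisers L := by
    intro u u' h h'
    rw [dist_self]
    positivity
  have hfin : denoisingLoss σ (modelLaw k) D ≠ ∞ := by
    have h1 := isMinOn_iff.1 hD.2 _ h0mem
    have : ∀ h, IsProbabilityMeasure (modelLaw k h) := fun h => by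
      unfold modelLaw; infer_instance
    rw [denoisingLoss_zero (fun h => by
      rw [modelLaw, ae_dirac_eq]; exact norm_oscMap k h)] at h1
    exact (h1.trans_lt ENNReal.one_lt_top).ne
  -- The projected denoiser is admissible, so by minimality the gain from projecting is zero.
  have hzero : (∫⁻ h : unitInterval, ∫⁻ η, ‖D (oscMap k h + η) h - π (D (oscMap k h + η) h)‖ₑ ^ 2
      ∂gaussianNoise σ) = 0 := by
    rw [← nonpos_iff_eq_zero]
    refine (ENNReal.add_le_add_iff_left hfin).1 ?_
    rw [add_zero]
    exact (add_le_add_left hmin _).trans hle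
  have hDc := continuous_of_mem_lipschitzDenoisers hL hD.1
  have hπc : Continuous π := (LipschitzWith.of_dist_le_mul (K := 1) fun x y => by
    simpa [dist_eq_norm] using hπ x y).continuous
  have hosc : Continuous fun h : unitInterval => oscMap k h :=
    (continuous_oscMap k).comp continuous_subtype_val
  have hEc : Continuous fun q : unitInterval × Plane => D (oscMap k q.1 + q.2) q.1 :=
    hDc.comp (f := fun q : unitInterval × Plane => (oscMap k q.1 + q.2, q.1))
      (((hosc.comp continuous_fst).add continuous_snd).prodMk continuous_fst)
  have hgc : Continuous fun q : unitInterval × Plane =>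
      ‖D (oscMap k q.1 + q.2) q.1 - π (D (oscMap k q.1 + q.2) q.1)‖ₑ ^ 2 :=
    (ENNReal.continuous_pow 2).comp (hEc.sub (hπc.comp hEc)).enorm
  have hprod : ∫⁻ q : unitInterval × Plane,
      ‖D (oscMap k q.1 + q.2) q.1 - π (D (oscMap k q.1 + q.2) q.1)‖ₑ ^ 2
        ∂(volume.prod (gaussianNoise σ)) = 0 := by
    rw [lintegral_prod _ hgc.measurable.aemeasurable]
    exact hzero
  have := isOpenPosMeasure_gaussianNoise hσ
  have hvol := isOpenPosMeasure_unitInterval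
  have heq := Continuous.ae_eq_iff_eq (volume.prod (gaussianNoise σ)) hgc
    (continuous_const (y := (0 : ℝ≥0∞))) |>.1
    ((lintegral_eq_zero_iff hgc.measurable).1 hprod)
  have h1 := congrFun heq (h, u - oscMap k h)
  simp only [add_sub_cancel] at h1
  have h2 : D u h = π (D u h) := by
    simpa [sub_eq_zero] using h1
  rw [h2]
  exact hπ1 _

/-- Arzelà–Ascoli in pointwise form: compactness gives convergence along a dense sequence, and the
common Lipschitz constant spreads it to all points. -/
lemma exists_tendsto_subseq_of_equilipschitz {X E : Type*} [PseudoMetricSpace X]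
    [TopologicalSpace.SeparableSpace X] [NormedAddCommGroup E] [NormedSpace ℝ E] [FiniteDimensional ℝ E]
    {K : NNReal} {F : ℕ → X → E} (hF : ∀ n, LipschitzWith K (F n)) {R : ℝ}
    (hb : ∀ n x, ‖F n x‖ ≤ R) :
    ∃ (φ : ℕ → ℕ) (G : X → E), StrictMono φ ∧ ∀ x, Tendsto (fun n => F (φ n) x) atTop (nhds (G x)) := by
  rcases isEmpty_or_nonempty X with hX | hX
  · exact ⟨id, fun x => hX.elim x, strictMono_id, fun x => hX.elim x⟩
  have : ProperSpace E := FiniteDimensional.proper ℝ E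
  obtain ⟨g, -, φ, hφ, hg⟩ :=
    (isCompact_univ_pi (fun _ : ℕ => isCompact_closedBall (0 : E) R)).tendsto_subseq
      (x := fun n i => F n (TopologicalSpace.denseSeq X i)) (fun n i _ => by simpa using hb n _)
  have hc : ∀ x, CauchySeq fun n => F (φ n) x := by
    intro x
    rw [Metric.cauchySeq_iff']
    intro δ hδ
    have hK : (0 : ℝ) < K + 1 := by positivity
    obtain ⟨i, hi⟩ := (TopologicalSpace.denseRange_denseSeq X).exists_dist_lt x
      (show 0 < δ / (4 * (K + 1)) by positivity)
    have hcq : CauchySeq fun n => F (φ n) (TopologicalSpace.denseSeq X i) :=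
      ((tendsto_pi_nhds.1 hg) i).cauchySeq
    obtain ⟨N, hN⟩ := Metric.cauchySeq_iff'.1 hcq (δ / 2) (by positivity)
    refine ⟨N, fun n hn => ?_⟩
    have hl : ∀ n, dist (F (φ n) x) (F (φ n) (TopologicalSpace.denseSeq X i)) ≤ δ / 4 := by
      intro n
      refine ((hF (φ n)).dist_le_mul _ _).trans ?_
      calc (K : ℝ) * dist x (TopologicalSpace.denseSeq X i)
          ≤ (K + 1) * (δ / (4 * (K + 1))) := by
            gcongr
            linarith
        _ = δ / 4 := by field_simp
    have h1 := hl n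
    have h2 := hl N
    rw [dist_comm] at h2
    have h3 := dist_triangle4 (F (φ n) x) (F (φ n) (TopologicalSpace.denseSeq X i))
      (F (φ N) (TopologicalSpace.denseSeq X i)) (F (φ N) x)
    linarith [hN n hn]
  choose G hG using fun x => cauchySeq_tendsto_of_complete (hc x)
  exact ⟨φ, G, hφ, hG⟩

/-- Direct method: a minimizing sequence is projected onto the unit ball for compactness, a
pointwise limit remains Lipschitz, and Fatou's lemma gives lower semicontinuity of the loss. -/
lemma exists_isConstrainedOptimalDenoiser {L : ℝ} (hL : 0 ≤ L) (σ : ℝ) (k : ℕ) :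
    ∃ D, IsConstrainedOptimalDenoiser L σ (modelLaw k) D := by
  obtain ⟨π, hπ1, hπ, hπ2⟩ := exists_unitBall_projection
  have hne : (denoisingLoss σ (modelLaw k) '' lipschitzDenoisers L).Nonempty := by
    refine ⟨_, fun _ _ => 0, fun u u' h h' => ?_, rfl⟩
    rw [dist_self]
    positivity
  obtain ⟨c, -, hc, hcm⟩ := exists_seq_tendsto_sInf hne (OrderBot.bddBelow _)
  choose D₀ hD₀ hD₀c using hcm
  set D : ℕ → Plane → unitInterval → Plane := fun n u h => π (D₀ n u h) with hDdef
  have hD : ∀ n, D n ∈ lipschitzDenoisers L := fun n => comp_mem_lipschitzDenoisers (hD₀ n) hπ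
  have hDc : ∀ n, denoisingLoss σ (modelLaw k) (D n) ≤ c n := by
    intro n
    rw [← hD₀c n]
    exact le_self_add.trans (denoisingLoss_modelLaw_comp_projection hL (hD₀ n) hπ hπ2)
  obtain ⟨φ, G, hφ, hG⟩ := exists_tendsto_subseq_of_equilipschitz
    (fun n => lipschitzWith_of_mem_lipschitzDenoisers hL (hD n)) (R := 1)
    (fun n x => hπ1 (D₀ n x.1 x.2))
  have hG' : ∀ u h, Tendsto (fun n => D (φ n) u h) atTop (nhds (G (u, h))) := fun u h => hG (u, h)
  refine ⟨fun u h => G (u, h), fun u u' h h' => ?_, fun D' hD' => ?_⟩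
  · exact le_of_tendsto' ((hG' u h).dist (hG' u' h')) fun n => hD (φ n) u u' h h'
  · refine le_trans ?_ (sInf_le (α := ℝ≥0∞) (Set.mem_image_of_mem _ hD'))
    have hmeas : ∀ n, Measurable fun q : unitInterval × Plane =>
        ‖D (φ n) (oscMap k q.1 + q.2) q.1 - oscMap k q.1‖ₑ ^ 2 := fun n =>
      measurable_modelLoss_integrand (continuous_of_mem_lipschitzDenoisers hL (hD (φ n))).measurable
    calc denoisingLoss σ (modelLaw k) (fun u h => G (u, h))
        = ∫⁻ h : unitInterval, ∫⁻ η, liminf (fun n =>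
            ‖D (φ n) (oscMap k h + η) h - oscMap k h‖ₑ ^ 2) atTop ∂gaussianNoise σ := by
          rw [denoisingLoss_modelLaw]
          refine lintegral_congr fun h => lintegral_congr fun η => ?_
          refine (Tendsto.liminf_eq ?_).symm
          exact ((ENNReal.continuous_pow 2).tendsto _).comp
            (((hG' (oscMap k h + η) h).sub_const _).enorm)
      _ ≤ ∫⁻ h : unitInterval, liminf (fun n => ∫⁻ η,
            ‖D (φ n) (oscMap k h + η) h - oscMap k h‖ₑ ^ 2 ∂gaussianNoise σ) atTop := by
          refine lintegral_mono fun h => lintegral_liminf_le fun n => ?_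
          exact measurable_enorm_sub_sq_left
            (continuous_of_mem_lipschitzDenoisers hL (hD (φ n))).measurable h (oscMap k h)
      _ ≤ liminf (fun n => ∫⁻ h : unitInterval, ∫⁻ η,
            ‖D (φ n) (oscMap k h + η) h - oscMap k h‖ₑ ^ 2 ∂gaussianNoise σ) atTop :=
          lintegral_liminf_le fun n => (hmeas n).lintegral_prod_right'
      _ ≤ liminf (fun n => c (φ n)) atTop := by
          refine liminf_le_liminf (Eventually.of_forall fun n => ?_)
          simp only [← denoisingLoss_modelLaw]
          exact hDc (φ n)
      _ = _ := (hc.comp hφ.tendsto_atTop).liminf_eq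

/-! ### Averaging of fast oscillations -/

lemma integral_integral_swap_of_continuous {g : ℝ → ℝ → ℝ} (hg : Continuous (Function.uncurry g))
    {B : ℝ} (hB : ∀ x y, |g x y| ≤ B) :
    ∫ x in (0 : ℝ)..1, ∫ y in (0 : ℝ)..1, g x y = ∫ y in (0 : ℝ)..1, ∫ x in (0 : ℝ)..1, g x y := by
  simp_rw [← integral_unitInterval]
  refine integral_integral_swap (f := fun x y : unitInterval => g x y) ?_
  refine Integrable.of_bound (Continuous.aestronglyMeasurable ?_) B
    (Eventually.of_forall fun q => hB _ _)
  exact hg.comp (f := fun q : unitInterval × unitInterval => ((q.1 : ℝ), (q.2 : ℝ))) (by fun_prop)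

/-- By periodicity the double mean is the average over phases `τ` of the integrals of `f x (k * x +
τ)`. A phase `τ` is a shift of `x` by `τ / k ≤ 1 / k`, which costs `Λ / k` in the slow variable and
`B / k` for each of the two boundary pieces. -/
lemma abs_integral_oscillating_sub_le {f : ℝ → ℝ → ℝ} (hf : Continuous (Function.uncurry f))
    (hp : ∀ x, Function.Periodic (f x) 1) {B Λ : ℝ} (hB : ∀ x y, |f x y| ≤ B)
    (hΛ : ∀ x x' y, |f x y - f x' y| ≤ Λ * |x - x'|) {k : ℕ} (hk : 0 < k) :
    |(∫ x in (0 : ℝ)..1, f x (k * x)) - ∫ x in (0 : ℝ)..1, ∫ y in (0 : ℝ)..1, f x y|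
      ≤ (Λ + 2 * B) / k := by
  have hk' : (0 : ℝ) < k := by exact_mod_cast hk
  have hB0 : 0 ≤ B := (abs_nonneg _).trans (hB 0 0)
  have hΛ0 : 0 ≤ Λ := by simpa using (abs_nonneg _).trans (hΛ 1 0 0)
  have hcomp : ∀ u v : ℝ → ℝ, Continuous u → Continuous v → Continuous fun x => f (u x) (v x) :=
    fun u v hu hv => hf.comp (hu.prodMk hv)
  have ii : ∀ (u v : ℝ → ℝ) (a b : ℝ), Continuous u → Continuous v →
      IntervalIntegrable (fun x => f (u x) (v x)) volume a b :=
    fun u v a b hu hv => (hcomp u v hu hv).intervalIntegrable _ _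
  have hmean : ∫ x in (0 : ℝ)..1, ∫ y in (0 : ℝ)..1, f x y
      = ∫ τ in (0 : ℝ)..1, ∫ x in (0 : ℝ)..1, f x (k * x + τ) := by
    rw [← integral_integral_swap_of_continuous (g := fun x τ => f x (k * x + τ))
      (hf.comp (f := fun q : ℝ × ℝ => (q.1, k * q.1 + q.2)) (by fun_prop)) (fun _ _ => hB _ _)]
    refine intervalIntegral.integral_congr fun x _ => ?_
    rw [intervalIntegral.integral_comp_add_left (f x) (k * x)]
    have := (hp x).intervalIntegral_add_eq (k * x) 0
    simpa using this.symm
  have hshift : ∀ τ ∈ Set.uIoc (0 : ℝ) 1,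
      ‖(∫ x in (0 : ℝ)..1, f x (k * x)) - ∫ x in (0 : ℝ)..1, f x (k * x + τ)‖
        ≤ (Λ + 2 * B) / k := by
    intro τ hτ
    rw [Set.uIoc_of_le zero_le_one] at hτ
    set s := τ / k with hs
    have hs0 : 0 ≤ s := by have := hτ.1; positivity
    have hs1 : s ≤ 1 / k := by rw [hs]; gcongr; exact hτ.2
    have h1 : ∫ x in (0 : ℝ)..1, f x (k * x + τ) = ∫ x in s..(1 + s), f (x - s) (k * x) := by
      have := intervalIntegral.integral_comp_add_right (a := 0) (b := 1)
        (fun x => f (x - s) (k * x)) s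
      rw [zero_add] at this
      rw [← this]
      refine intervalIntegral.integral_congr fun x _ => ?_
      simp only [add_sub_cancel_right, mul_add, hs]
      rw [mul_div_cancel₀ _ hk'.ne']
    have h2 : (∫ x in (0 : ℝ)..1, f x (k * x)) - ∫ x in s..(1 + s), f (x - s) (k * x)
        = (∫ x in (0 : ℝ)..s, f x (k * x)) - (∫ x in (1 : ℝ)..(1 + s), f x (k * x))
          + ∫ x in s..(1 + s), (f x (k * x) - f (x - s) (k * x)) := by
      have c1 : ∀ a b, IntervalIntegrable (fun x => f x (k * x)) volume a b :=
        fun a b => ii (fun x => x) _ a b (by fun_prop) (by fun_prop)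
      rw [intervalIntegral.integral_sub (c1 _ _) (ii _ _ _ _ (by fun_prop) (by fun_prop))]
      have e1 := intervalIntegral.integral_add_adjacent_intervals (c1 0 s) (c1 s (1 + s))
      have e2 := intervalIntegral.integral_add_adjacent_intervals (c1 0 1) (c1 1 (1 + s))
      linarith
    have b1 : ‖∫ x in (0 : ℝ)..s, f x (k * x)‖ ≤ B * |s - 0| :=
      intervalIntegral.norm_integral_le_of_norm_le_const fun x _ => hB _ _
    have b2 : ‖∫ x in (1 : ℝ)..(1 + s), f x (k * x)‖ ≤ B * |1 + s - 1| :=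
      intervalIntegral.norm_integral_le_of_norm_le_const fun x _ => hB _ _
    have b3 : ‖∫ x in s..(1 + s), (f x (k * x) - f (x - s) (k * x))‖ ≤ Λ * s * |1 + s - s| := by
      refine intervalIntegral.norm_integral_le_of_norm_le_const fun x _ => ?_
      refine (hΛ _ _ _).trans_eq ?_
      rw [sub_sub_cancel, abs_of_nonneg hs0]
    rw [sub_zero, abs_of_nonneg hs0] at b1
    rw [add_sub_cancel_left, abs_of_nonneg hs0] at b2
    rw [add_sub_cancel_right, abs_one, mul_one] at b3
    rw [h1, h2]
    calc _ ≤ B * s + B * s + Λ * s :=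
          (norm_add_le _ _).trans (add_le_add ((norm_sub_le _ _).trans (add_le_add b1 b2)) b3)
      _ = (Λ + 2 * B) * s := by ring
      _ ≤ (Λ + 2 * B) * (1 / k) := by gcongr
      _ = _ := by ring
  have hcont : Continuous fun τ : ℝ => ∫ x in (0 : ℝ)..1, f x (k * x + τ) :=
    intervalIntegral.continuous_parametric_intervalIntegral_of_continuous'
      (f := fun τ x => f x (k * x + τ))
      (hf.comp (f := fun q : ℝ × ℝ => (q.2, k * q.2 + q.1)) (by fun_prop)) _ _
  have hfin : (∫ x in (0 : ℝ)..1, f x (k * x)) - ∫ x in (0 : ℝ)..1, ∫ y in (0 : ℝ)..1, f x y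
      = ∫ τ in (0 : ℝ)..1, ((∫ x in (0 : ℝ)..1, f x (k * x))
          - ∫ x in (0 : ℝ)..1, f x (k * x + τ)) := by
    rw [intervalIntegral.integral_sub (by simp) (hcont.intervalIntegrable _ _), hmean]
    simp
  rw [hfin]
  simpa using intervalIntegral.norm_integral_le_of_norm_le_const hshift

/-- The mean square error of a denoiser at the index `x` (clamped to `[0,1]`) and at the point of the
circle with phase `t`. -/
noncomputable def phaseLoss (σ : ℝ) (D : Plane → unitInterval → Plane) (x t : ℝ) : ℝ :=
  ∫ η, ‖D (oscMap 1 t + η) (Set.projIcc 0 1 zero_le_one x) - oscMap 1 t‖ ^ 2 ∂gaussianNoise σ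

/-! ### Averaging applied to the loss of a bounded Lipschitz denoiser -/

section phaseLoss

variable {D : Plane → unitInterval → Plane}

lemma norm_sub_oscMap_sq_le (hD1 : ∀ u h, ‖D u h‖ ≤ 1) (u : Plane) (h : unitInterval) (t : ℝ) :
    ‖D u h - oscMap 1 t‖ ^ 2 ≤ 4 := by
  have : ‖D u h - oscMap 1 t‖ ≤ 2 := (norm_sub_le _ _).trans (by
    rw [norm_oscMap]; linarith [hD1 u h])
  nlinarith [norm_nonneg (D u h - oscMap 1 t)]

lemma continuous_norm_sub_sq (hDc : Continuous (Function.uncurry D)) {X : Type*}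
    [TopologicalSpace X] {a c : X → Plane} {p : X → unitInterval} (ha : Continuous a)
    (hp : Continuous p) (hc : Continuous c) : Continuous fun x => ‖D (a x) (p x) - c x‖ ^ 2 :=
  ((hDc.comp (ha.prodMk hp)).sub hc).norm.pow 2

lemma integrable_phaseLoss_integrand (σ : ℝ) (hDc : Continuous (Function.uncurry D))
    (hD1 : ∀ u h, ‖D u h‖ ≤ 1) (x t : ℝ) :
    Integrable (fun η => ‖D (oscMap 1 t + η) (Set.projIcc 0 1 zero_le_one x) - oscMap 1 t‖ ^ 2)
      (gaussianNoise σ) := by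
  refine Integrable.of_bound (Continuous.aestronglyMeasurable ?_) 4 (Eventually.of_forall fun η => ?_)
  · exact continuous_norm_sub_sq hDc (by fun_prop) continuous_const continuous_const
  · rw [Real.norm_of_nonneg (by positivity)]
    exact norm_sub_oscMap_sq_le hD1 _ _ _

lemma continuous_phaseLoss (σ : ℝ) (hDc : Continuous (Function.uncurry D))
    (hD1 : ∀ u h, ‖D u h‖ ≤ 1) : Continuous (Function.uncurry (phaseLoss σ D)) := by
  refine continuous_of_dominated (bound := fun _ => 4)
    (fun q => (integrable_phaseLoss_integrand σ hDc hD1 q.1 q.2).1)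
    (fun q => Eventually.of_forall fun η => ?_) (integrable_const _)
    (Eventually.of_forall fun η => ?_)
  · rw [Real.norm_of_nonneg (by positivity)]
    exact norm_sub_oscMap_sq_le hD1 _ _ _
  · have h1 : Continuous fun q : ℝ × ℝ => oscMap 1 q.2 := (continuous_oscMap 1).comp continuous_snd
    exact continuous_norm_sub_sq hDc (h1.add continuous_const)
      (continuous_projIcc.comp continuous_fst) h1

lemma phaseLoss_nonneg (σ : ℝ) (D : Plane → unitInterval → Plane) (x t : ℝ) :
    0 ≤ phaseLoss σ D x t :=
  integral_nonneg fun _ => by positivity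

lemma phaseLoss_le (σ : ℝ) (hDc : Continuous (Function.uncurry D))
    (hD1 : ∀ u h, ‖D u h‖ ≤ 1) (x t : ℝ) : phaseLoss σ D x t ≤ 4 :=
  (integral_mono (integrable_phaseLoss_integrand σ hDc hD1 x t) (integrable_const 4)
    fun _ => norm_sub_oscMap_sq_le hD1 _ _ _).trans (by simp)

/-- Only the slow index moves: the phase `t` is frozen, so the oscillation does not enter the
Lipschitz constant. The factor 4 comes from a difference of squares of norms at most 2. -/
lemma abs_phaseLoss_sub_le (σ : ℝ) {L : ℝ} (hL : 0 ≤ L) (hD : D ∈ lipschitzDenoisers L)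
    (hD1 : ∀ u h, ‖D u h‖ ≤ 1) (x x' t : ℝ) :
    |phaseLoss σ D x t - phaseLoss σ D x' t| ≤ 4 * L * |x - x'| := by
  have hDc := continuous_of_mem_lipschitzDenoisers hL hD
  unfold phaseLoss
  rw [← integral_sub (integrable_phaseLoss_integrand σ hDc hD1 x t)
    (integrable_phaseLoss_integrand σ hDc hD1 x' t), ← Real.norm_eq_abs]
  refine (norm_integral_le_of_norm_le_const (C := 4 * L * |x - x'|)
    (Eventually.of_forall fun η => ?_)).trans (by simp)
  set p := Set.projIcc (0 : ℝ) 1 zero_le_one x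
  set p' := Set.projIcc (0 : ℝ) 1 zero_le_one x'
  set u := oscMap 1 t + η
  have h1 : ‖D u p - D u p'‖ ≤ L * |x - x'| := by
    have := hD u u p p'
    rw [dist_self, zero_pow two_ne_zero, zero_add, Real.sqrt_sq dist_nonneg, dist_eq_norm] at this
    refine this.trans ?_
    gcongr
    rw [Subtype.dist_eq, Real.dist_eq]
    exact Set.abs_projIcc_sub_projIcc zero_le_one
  have h2 : ∀ q, ‖D u q - oscMap 1 t‖ ≤ 2 := fun q => (norm_sub_le _ _).trans (by
    rw [norm_oscMap]; linarith [hD1 u q])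
  have h3 : |‖D u p - oscMap 1 t‖ - ‖D u p' - oscMap 1 t‖| ≤ ‖D u p - D u p'‖ := by
    simpa using abs_norm_sub_norm_le (D u p - oscMap 1 t) (D u p' - oscMap 1 t)
  rw [Real.norm_eq_abs, sq_sub_sq, abs_mul,
    abs_of_nonneg (add_nonneg (norm_nonneg (D u p - oscMap 1 t)) (norm_nonneg _))]
  calc _ ≤ (2 + 2) * (L * |x - x'|) := by
        gcongr
        · exact h2 p
        · exact h2 p'
        · exact h3.trans h1
    _ = _ := by ring

lemma lintegral_eq_phaseLoss (σ : ℝ) (hDc : Continuous (Function.uncurry D))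
    (hD1 : ∀ u h, ‖D u h‖ ≤ 1) (h : unitInterval) (t : ℝ) :
    ∫⁻ η, ‖D (oscMap 1 t + η) h - oscMap 1 t‖ₑ ^ 2 ∂gaussianNoise σ
      = ENNReal.ofReal (phaseLoss σ D h t) := by
  rw [phaseLoss, ofReal_integral_eq_lintegral_ofReal (integrable_phaseLoss_integrand σ hDc hD1 h t)
    (Eventually.of_forall fun _ => by positivity)]
  simp_rw [Set.projIcc_val, enorm_sq_eq_ofReal]

lemma lintegral_unitInterval_ofReal {g : ℝ → ℝ} (hg : Continuous g) (hg0 : ∀ x, 0 ≤ g x) {B : ℝ}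
    (hB : ∀ x, g x ≤ B) :
    ∫⁻ x : unitInterval, ENNReal.ofReal (g x) = ENNReal.ofReal (∫ x in (0 : ℝ)..1, g x) := by
  rw [← integral_unitInterval, ofReal_integral_eq_lintegral_ofReal (f := fun x : unitInterval => g x) _
    (Eventually.of_forall fun x => hg0 x)]
  refine Integrable.of_bound (hg.comp continuous_subtype_val).aestronglyMeasurable B
    (Eventually.of_forall fun x => ?_)
  rw [Real.norm_of_nonneg (hg0 _)]
  exact hB _

lemma denoisingLoss_modelLaw_eq_phaseLoss (σ : ℝ) (k : ℕ) (hDc : Continuous (Function.uncurry D))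
    (hD1 : ∀ u h, ‖D u h‖ ≤ 1) :
    denoisingLoss σ (modelLaw k) D
      = ENNReal.ofReal (∫ x in (0 : ℝ)..1, phaseLoss σ D x (k * x)) := by
  rw [denoisingLoss_modelLaw, ← lintegral_unitInterval_ofReal (B := 4)
    (g := fun x => phaseLoss σ D x (k * x)) _ (fun _ => phaseLoss_nonneg _ _ _ _)
    (fun _ => phaseLoss_le σ hDc hD1 _ _)]
  · refine lintegral_congr fun h => ?_
    rw [oscMap_eq_one, lintegral_eq_phaseLoss σ hDc hD1]
  · exact (continuous_phaseLoss σ hDc hD1).comp (f := fun x : ℝ => (x, k * x)) (by fun_prop)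

lemma denoisingLoss_uniformCircle_eq_phaseLoss (σ : ℝ) (hDc : Continuous (Function.uncurry D))
    (hD1 : ∀ u h, ‖D u h‖ ≤ 1) :
    denoisingLoss σ (fun _ => uniformCircle) D
      = ENNReal.ofReal (∫ x in (0 : ℝ)..1, ∫ t in (0 : ℝ)..1, phaseLoss σ D x t) := by
  have hc := continuous_phaseLoss σ hDc hD1
  rw [← lintegral_unitInterval_ofReal (B := 4) (g := fun x => ∫ t in (0 : ℝ)..1, phaseLoss σ D x t)]
  · unfold denoisingLoss
    refine lintegral_congr fun h => ?_
    have hDh : Measurable fun u => D u h := hDc.measurable.of_uncurry_right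
    have hm : Measurable fun q : Plane × Plane => ‖D (q.1 + q.2) h - q.1‖ₑ ^ 2 :=
      ((hDh.comp measurable_add).sub measurable_fst).enorm.pow_const 2
    have hm' : Measurable fun u => ∫⁻ η, ‖D (u + η) h - u‖ₑ ^ 2 ∂gaussianNoise σ :=
      hm.lintegral_prod_right'
    have hch : Continuous fun t => phaseLoss σ D h t :=
      hc.comp (f := fun t : ℝ => ((h : ℝ), t)) (by fun_prop)
    rw [uniformCircle_eq_map, lintegral_map hm' measurable_oscMap_coe,
      ← lintegral_unitInterval_ofReal (B := 4) (g := fun t => phaseLoss σ D h t)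
        hch
        (fun _ => phaseLoss_nonneg _ _ _ _) (fun _ => phaseLoss_le σ hDc hD1 _ _)]
    exact lintegral_congr fun t => lintegral_eq_phaseLoss σ hDc hD1 h t
  · exact intervalIntegral.continuous_parametric_intervalIntegral_of_continuous' hc _ _
  · exact fun x => intervalIntegral.integral_nonneg zero_le_one fun _ _ => phaseLoss_nonneg _ _ _ _
  · intro x
    have := intervalIntegral.norm_integral_le_of_norm_le_const (a := 0) (b := 1) (C := 4)
      (f := phaseLoss σ D x) fun t _ => by
        rw [Real.norm_of_nonneg (phaseLoss_nonneg _ _ _ _)]; exact phaseLoss_le σ hDc hD1 _ _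
    simpa using (le_abs_self _).trans this

/-- For Lipschitz denoisers, the loss of the oscillating model is close to the loss of the uniform
distribution on the circle. -/
lemma abs_integral_phaseLoss_sub_le (σ : ℝ) {L : ℝ} (hL : 0 ≤ L) (hD : D ∈ lipschitzDenoisers L)
    (hD1 : ∀ u h, ‖D u h‖ ≤ 1) {k : ℕ} (hk : 0 < k) :
    |(∫ x in (0 : ℝ)..1, phaseLoss σ D x (k * x))
        - ∫ x in (0 : ℝ)..1, ∫ t in (0 : ℝ)..1, phaseLoss σ D x t| ≤ (4 * L + 2 * 4) / k := by
  have hDc := continuous_of_mem_lipschitzDenoisers hL hD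
  refine abs_integral_oscillating_sub_le (continuous_phaseLoss σ hDc hD1) (fun x t => ?_)
    (fun x t => ?_) (abs_phaseLoss_sub_le σ hL hD hD1) hk
  · simp only [phaseLoss, oscMap_one_periodic t]
  · rw [abs_of_nonneg (phaseLoss_nonneg _ _ _ _)]
    exact phaseLoss_le σ hDc hD1 x t

lemma denoisingLoss_uniformCircle_le (σ : ℝ) {L : ℝ} (hL : 0 ≤ L) (hD : D ∈ lipschitzDenoisers L)
    (hD1 : ∀ u h, ‖D u h‖ ≤ 1) {k : ℕ} (hk : 0 < k) :
    denoisingLoss σ (fun _ => uniformCircle) D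
      ≤ denoisingLoss σ (modelLaw k) D + ENNReal.ofReal ((4 * L + 2 * 4) / k) := by
  have hDc := continuous_of_mem_lipschitzDenoisers hL hD
  rw [denoisingLoss_uniformCircle_eq_phaseLoss σ hDc hD1,
    denoisingLoss_modelLaw_eq_phaseLoss σ k hDc hD1]
  refine le_trans (ENNReal.ofReal_le_ofReal ?_) ENNReal.ofReal_add_le
  linarith [abs_le.1 (abs_integral_phaseLoss_sub_le σ hL hD hD1 hk)]

lemma denoisingLoss_modelLaw_le (σ : ℝ) {L : ℝ} (hL : 0 ≤ L) (hD : D ∈ lipschitzDenoisers L)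
    (hD1 : ∀ u h, ‖D u h‖ ≤ 1) {k : ℕ} (hk : 0 < k) :
    denoisingLoss σ (modelLaw k) D
      ≤ denoisingLoss σ (fun _ => uniformCircle) D + ENNReal.ofReal ((4 * L + 2 * 4) / k) := by
  have hDc := continuous_of_mem_lipschitzDenoisers hL hD
  rw [denoisingLoss_uniformCircle_eq_phaseLoss σ hDc hD1,
    denoisingLoss_modelLaw_eq_phaseLoss σ k hDc hD1]
  refine le_trans (ENNReal.ofReal_le_ofReal ?_) ENNReal.ofReal_add_le
  linarith [abs_le.1 (abs_integral_phaseLoss_sub_le σ hL hD hD1 hk)]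

end phaseLoss

/-! ### The main theorem -/

lemma enorm_sub_sq_le_two_mul (a b c : Plane) :
    ‖a - c‖ₑ ^ 2 ≤ 2 * ‖a - b‖ₑ ^ 2 + 2 * ‖b - c‖ₑ ^ 2 := by
  simp only [enorm_sq_eq_ofReal]
  have h2 : ENNReal.ofReal 2 = 2 := by simp
  calc ENNReal.ofReal (‖a - c‖ ^ 2)
      ≤ ENNReal.ofReal (2 * ‖a - b‖ ^ 2 + 2 * ‖b - c‖ ^ 2) := by
        refine ENNReal.ofReal_le_ofReal ?_
        have h := norm_sub_le_norm_sub_add_norm_sub a b c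
        nlinarith [norm_nonneg (a - c), sq_nonneg (‖a - b‖ - ‖b - c‖)]
    _ = _ := by
        rw [ENNReal.ofReal_add (by positivity) (by positivity), ENNReal.ofReal_mul zero_le_two,
          ENNReal.ofReal_mul zero_le_two, h2]

lemma denoiserSqDist_le_two_mul {σ : ℝ} (hσ : 0 < σ) {D₁ D₂ D₃ : Plane → unitInterval → Plane}
    (h₁ : Measurable (Function.uncurry D₁)) (h₂ : Measurable (Function.uncurry D₂))
    (h₃ : Measurable (Function.uncurry D₃)) :
    denoiserSqDist σ D₁ D₃ ≤ 2 * denoiserSqDist σ D₁ D₂ + 2 * denoiserSqDist σ D₂ D₃ := by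
  have hmass : Measurable (circlePosteriorMass σ) :=
    (measurable_posteriorMass (m := (volume : Measure unitInterval))
      (T := fun (_ : unitInterval) (t : unitInterval) => oscMap 1 t)
      (measurable_oscMap_coe.comp measurable_snd) σ).comp
      (f := fun y : Plane => (y, (0 : unitInterval))) (by fun_prop)
  have hm : Measurable fun q : unitInterval × Plane =>
      ENNReal.ofReal (circlePosteriorMass σ q.2) * ‖D₁ q.2 q.1 - D₂ q.2 q.1‖ₑ ^ 2 :=
    (hmass.comp measurable_snd).ennreal_ofReal.mul
      (((h₁.sub h₂).comp measurable_swap).enorm.pow_const 2)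
  have hmh : ∀ h, Measurable fun y =>
      ENNReal.ofReal (circlePosteriorMass σ y) * ‖D₁ y h - D₂ y h‖ₑ ^ 2 := fun h =>
    hmass.ennreal_ofReal.mul
      (((h₁.of_uncurry_right (y := h)).sub (h₂.of_uncurry_right (y := h))).enorm.pow_const 2)
  rw [denoiserSqDist_eq hσ h₁ h₃, denoiserSqDist_eq hσ h₁ h₂, denoiserSqDist_eq hσ h₂ h₃,
    ← mul_add, ← lintegral_add_left hm.lintegral_prod_right',
    ← lintegral_const_mul' _ _ ENNReal.ofNat_ne_top]
  refine lintegral_mono fun h => ?_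
  simp only
  rw [← lintegral_add_left (hmh h), ← lintegral_const_mul' _ _ ENNReal.ofNat_ne_top]
  refine lintegral_mono fun y => ?_
  calc _ ≤ ENNReal.ofReal (circlePosteriorMass σ y)
        * (2 * ‖D₁ y h - D₂ y h‖ₑ ^ 2 + 2 * ‖D₂ y h - D₃ y h‖ₑ ^ 2) := by
        gcongr; exact enorm_sub_sq_le_two_mul _ _ _
    _ = _ := by ring

/-- The minimizer is compared with the competitor `G` by passing from the circle loss to the
oscillating loss and back. Each passage costs one averaging error, and the common loss of `M`, being
finite, cancels. -/
lemma IsConstrainedOptimalDenoiser.denoiserSqDist_circlePosteriorMean_le {L σ : ℝ} (hL : 36 ≤ L)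
    (hσ : 0 < σ) {k : ℕ} (hk : 0 < k) {D : Plane → unitInterval → Plane}
    (hD : IsConstrainedOptimalDenoiser L σ (modelLaw k) D) :
    denoiserSqDist σ D (fun y _ => circlePosteriorMean σ y)
      ≤ ENNReal.ofReal (Real.exp (-(L / 4))) + 2 * ENNReal.ofReal ((4 * L + 2 * 4) / k) := by
  have hL0 : 0 ≤ L := by linarith
  obtain ⟨G, hG, hG1, hGd⟩ := exists_lipschitz_near_circlePosteriorMean hL hσ
  have hGmem : (fun y _ => G y : Plane → unitInterval → Plane) ∈ lipschitzDenoisers L := by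
    intro u u' h h'
    rw [dist_eq_norm]
    refine (hG u u').trans ?_
    gcongr
    rw [← dist_eq_norm]
    exact Real.le_sqrt_of_sq_le (le_add_of_nonneg_right (sq_nonneg _))
  have hDm := (continuous_of_mem_lipschitzDenoisers hL0 hD.1).measurable
  have hGm := (continuous_of_mem_lipschitzDenoisers hL0 hGmem).measurable
  refine (ENNReal.add_le_add_iff_right (denoisingLoss_uniformCircle_ne_top hσ)).1 ?_
  rw [← denoisingLoss_uniformCircle hσ hDm]
  calc _ ≤ denoisingLoss σ (modelLaw k) D + ENNReal.ofReal ((4 * L + 2 * 4) / k) :=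
        denoisingLoss_uniformCircle_le σ hL0 hD.1 (hD.norm_le_one hL0 hσ) hk
    _ ≤ denoisingLoss σ (modelLaw k) (fun y _ => G y) + ENNReal.ofReal ((4 * L + 2 * 4) / k) := by
        gcongr
        exact isMinOn_iff.1 hD.2 _ hGmem
    _ ≤ denoisingLoss σ (fun _ => uniformCircle) (fun y _ => G y)
          + ENNReal.ofReal ((4 * L + 2 * 4) / k) + ENNReal.ofReal ((4 * L + 2 * 4) / k) := by
        gcongr
        exact denoisingLoss_modelLaw_le σ hL0 hGmem (fun u _ => hG1 u) hk
    _ ≤ _ := by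
        rw [denoisingLoss_uniformCircle hσ hGm]
        calc _ ≤ ENNReal.ofReal (Real.exp (-(L / 4)))
              + denoisingLoss σ (fun _ => uniformCircle) (fun y _ => circlePosteriorMean σ y)
              + ENNReal.ofReal ((4 * L + 2 * 4) / k) + ENNReal.ofReal ((4 * L + 2 * 4) / k) := by
              gcongr
          _ = _ := by ring

theorem mainTheorem4 :
    ∃ C L₀ : ℝ, 0 < C ∧ 0 < L₀ ∧
      ∀ L : ℝ, L₀ ≤ L → ∀ ε : ℝ, 0 < ε → ∀ σ : ℝ, 0 < σ →
        (∀ k : ℕ, ∃ D, IsConstrainedOptimalDenoiser L σ (modelLaw k) D) ∧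
        (∀ k : ℕ, ∃ D, IsOptimalDenoiser σ (smoothedLaw k ε) D) ∧
        ∀ D D' : ℕ → Plane → unitInterval → Plane,
          (∀ k, IsConstrainedOptimalDenoiser L σ (modelLaw k) (D k)) →
          (∀ k, IsOptimalDenoiser σ (smoothedLaw k ε) (D' k)) →
          limsup (fun k => denoiserSqDist σ (D k) (D' k)) atTop
            ≤ ENNReal.ofReal (C * Real.exp (-(L / (8 * C)))) := by
  -- `36` is the Lipschitz constant of the damped posterior mean. `C = 2` is the factor from `(a +
  -- b)² ≤ 2a² + 2b²`; the rate `L / 4` obtained is better than the required `L / (8 * 2)`.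
  refine ⟨2, 36, by norm_num, by norm_num, fun L hL ε hε σ hσ => ⟨fun k => ?_, fun k => ?_, ?_⟩⟩
  · exact exists_isConstrainedOptimalDenoiser (by linarith) σ k
  · exact exists_isOptimalDenoiser_smoothedLaw hσ hε k
  intro D D' hD hD'
  set b : ℕ → ℝ≥0∞ := fun k =>
    2 * (ENNReal.ofReal (Real.exp (-(L / 4))) + 2 * ENNReal.ofReal ((4 * L + 2 * 4) / k))
      + 2 * ENNReal.ofReal ((2 * (ε * k)⁻¹) ^ 2) with hb
  have hle : ∀ᶠ k in atTop, denoiserSqDist σ (D k) (D' k) ≤ b k := by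
    -- The averaging bounds divide by `k`, so `k = 0` is discarded.
    filter_upwards [eventually_gt_atTop 0] with k hk
    refine (denoiserSqDist_le_two_mul hσ
      (continuous_of_mem_lipschitzDenoisers (by linarith) (hD k).1).measurable
      (measurable_uncurry_circlePosteriorMean σ) (hD' k).1).trans ?_
    simp only [hb]
    gcongr
    · exact (hD k).denoiserSqDist_circlePosteriorMean_le hL hσ hk
    · exact (hD' k).denoiserSqDist_circlePosteriorMean_le hσ hε hk
  have hinv : Tendsto (fun k : ℕ => ((k : ℝ))⁻¹) atTop (nhds 0) := tendsto_inv_atTop_nhds_zero_nat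
  have h1 : Tendsto (fun k : ℕ => ENNReal.ofReal ((4 * L + 2 * 4) / k)) atTop (nhds 0) := by
    have := ENNReal.tendsto_ofReal (hinv.const_mul (4 * L + 2 * 4))
    simpa [div_eq_mul_inv] using this
  have h2 : Tendsto (fun k : ℕ => ENNReal.ofReal ((2 * (ε * k)⁻¹) ^ 2)) atTop (nhds 0) := by
    have := ENNReal.tendsto_ofReal (((hinv.const_mul ε⁻¹).const_mul 2).pow 2)
    simpa [mul_inv, mul_comm] using this
  have hlim : Tendsto b atTop (nhds (2 * (ENNReal.ofReal (Real.exp (-(L / 4))) + 2 * 0) + 2 * 0)) := by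
    have c2 : (2 : ℝ≥0∞) ≠ ∞ := ENNReal.ofNat_ne_top
    exact (ENNReal.Tendsto.const_mul (tendsto_const_nhds.add
      (ENNReal.Tendsto.const_mul h1 (Or.inr c2))) (Or.inr c2)).add
      (ENNReal.Tendsto.const_mul h2 (Or.inr c2))
  refine (limsup_le_limsup hle).trans ?_
  rw [hlim.limsup_eq, mul_zero, add_zero, add_zero,
    show (2 : ℝ≥0∞) = ENNReal.ofReal 2 by simp, ← ENNReal.ofReal_mul zero_le_two]
  refine ENNReal.ofReal_le_ofReal ?_
  gcongr
  norm_num
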